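/- A real Riesz space $X$ has order dual $X^{\sim}$, the Riesz space of its order bounded linear functionals; $X_n^{\sim}\subseteq X^{\sim}$ is the set of order continuous ones; $L_b(X)$ is the ordered algebra of order bounded linear operators on $X$ ($S\le T$ iff $Sx\le Tx$ for all $x\ge 0$); and $Orth(X)\subseteq L_b(X)$ is the set of order bounded operators that leave every band of $X$ invariant. Let $E$ be a real Riesz space whose order dual $E^{\sim}$ separates the points of $E$, and let $A=Orth(E)$, a unital algebra and a Riesz space. The space $(A^{\sim})_n^{\sim}$ carries the order induced by $A^{\sim\sim}$ and the Arens product $F\cdot G$, defined for $F,G\in (A^{\sim})_n^{\sim}$, $f\in A^{\sim}$, $a,b\in A$ by $$(f\cdot a)(b)=f(ab),\qquad (G\cdot f)(a)=G(f\cdot a),\qquad (F\cdot G)(f)=F(G\cdot f);$$ with this product it is an algebra whose unit is evaluation at the identity operator $I\in A$. For $x\in E$ and $f\in E^{\sim}$ let $\psi_{x,f}\in A^{\sim}$ be given by $\psi_{x,f}(\pi)=f(\pi x)$, and define the Arens homomorphism $$\gamma:(Orth(E)^{\sim})_n^{\sim}\to L_b(E^{\sim}),\qquad \gamma(F)(f)(x)=F(\psi_{x,f})\qquad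 (f\in E^{\sim},\ x\in E).$$ Then $\gamma$ is a unital algebra homomorphism, an order continuous map and a Riesz homomorphism. It extends the map $\pi\mapsto\pi'$: for every $\pi\in Orth(E)$, $\gamma$ sends the functional $\widehat{\pi}:\mu\mapsto\mu(\pi)$ on $Orth(E)^{\sim}$ to the adjoint $\pi':f\mapsto f\circ\pi$. Moreover $\gamma(F)\in Orth(E^{\sim})$ for every $F\in(Orth(E)^{\sim})_n^{\sim}$. -/

import Mathlib

set_option linter.unusedSectionVars false
set_option linter.unusedVariables false

universe u v w

namespace RieszSpace

/-! ### Order bounded operators -/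

section Basic

variable {E : Type u} [AddCommGroup E] [PartialOrder E] [IsOrderedAddMonoid E] [Module ℝ E]
variable {F : Type v} [AddCommGroup F] [PartialOrder F] [IsOrderedAddMonoid F] [Module ℝ F]
variable {G : Type w} [AddCommGroup G] [PartialOrder G] [IsOrderedAddMonoid G] [Module ℝ G]

/-- A linear map is order bounded if it maps order intervals into order intervals. -/
def IsOrderBounded (T : E →ₗ[ℝ] F) : Prop :=
  ∀ a b : E, ∃ c d : F, ∀ x ∈ Set.Icc a b, T x ∈ Set.Icc c d

theorem IsOrderBounded.zero : IsOrderBounded (0 : E →ₗ[ℝ] F) :=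
  fun _ _ => ⟨0, 0, fun _ _ => by simp⟩

theorem IsOrderBounded.add {S T : E →ₗ[ℝ] F} (hS : IsOrderBounded S) (hT : IsOrderBounded T) :
    IsOrderBounded (S + T) := by
  intro a b
  obtain ⟨c, d, h⟩ := hS a b
  obtain ⟨c', d', h'⟩ := hT a b
  exact ⟨c + c', d + d', fun x hx =>
    ⟨add_le_add (h x hx).1 (h' x hx).1, add_le_add (h x hx).2 (h' x hx).2⟩⟩

theorem IsOrderBounded.neg {S : E →ₗ[ℝ] F} (hS : IsOrderBounded S) : IsOrderBounded (-S) := by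
  intro a b
  obtain ⟨c, d, h⟩ := hS a b
  exact ⟨-d, -c, fun x hx => ⟨neg_le_neg (h x hx).2, neg_le_neg (h x hx).1⟩⟩

theorem IsOrderBounded.smul [IsOrderedModule ℝ F] (r : ℝ) {S : E →ₗ[ℝ] F}
    (hS : IsOrderBounded S) : IsOrderBounded (r • S) := by
  have key : ∀ r : ℝ, 0 ≤ r → IsOrderBounded (r • S) := by
    intro r hr a b
    obtain ⟨c, d, h⟩ := hS a b
    exact ⟨r • c, r • d, fun x hx => ⟨smul_le_smul_of_nonneg_left (h x hx).1 hr,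
      smul_le_smul_of_nonneg_left (h x hx).2 hr⟩⟩
  rcases le_total 0 r with hr | hr
  · exact key r hr
  · have := (key (-r) (neg_nonneg.2 hr)).neg
    simpa using this

theorem IsOrderBounded.comp {S : F →ₗ[ℝ] G} {T : E →ₗ[ℝ] F} (hS : IsOrderBounded S)
    (hT : IsOrderBounded T) : IsOrderBounded (S ∘ₗ T) := by
  intro a b
  obtain ⟨c, d, h⟩ := hT a b
  obtain ⟨c', d', h'⟩ := hS c d
  exact ⟨c', d', fun x hx => h' _ (h x hx)⟩

theorem IsOrderBounded.of_nonneg {T : E →ₗ[ℝ] F} (hT : ∀ x, 0 ≤ x → 0 ≤ T x) :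
    IsOrderBounded T := by
  have mono : ∀ x y, x ≤ y → T x ≤ T y := fun x y hxy => by
    have := hT (y - x) (sub_nonneg.2 hxy)
    rw [map_sub] at this
    exact sub_nonneg.1 this
  exact fun a b => ⟨T a, T b, fun x hx => ⟨mono _ _ hx.1, mono _ _ hx.2⟩⟩

theorem IsOrderBounded.of_sub {T P Q : E →ₗ[ℝ] F} (h : ∀ x, T x = P x - Q x)
    (hP : IsOrderBounded P) (hQ : IsOrderBounded Q) : IsOrderBounded T := by
  have : T = P + -Q := by
    ext x
    simp [h, sub_eq_add_neg]
  rw [this]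
  exact hP.add hQ.neg

end Basic

/-! ### Auxiliary constructions -/

/-- The lattice structure of a partially ordered abelian group in which every element has a
positive part. -/
abbrev latticeOfPosPart {G : Type u} [AddCommGroup G] [PartialOrder G] [IsOrderedAddMonoid G]
    (p : G → G) (h0 : ∀ x, 0 ≤ p x) (h1 : ∀ x, x ≤ p x)
    (h2 : ∀ x z, 0 ≤ z → x ≤ z → p x ≤ z) : Lattice G where
  sup x y := p (x - y) + y
  le_sup_left x y := by simpa using add_le_add_left (h1 (x - y)) y
  le_sup_right x y := le_add_of_nonneg_left (h0 _)
  sup_le x y z hx hy := by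
    have := h2 (x - y) (z - y) (sub_nonneg.2 hy) (sub_le_sub_right hx y)
    exact le_sub_iff_add_le.1 this
  inf x y := x - p (x - y)
  inf_le_left x y := sub_le_self _ (h0 _)
  inf_le_right x y := sub_le_comm.1 (h1 _)
  le_inf x y z hx hy := le_sub_comm.1 (h2 _ _ (sub_nonneg.2 hx) (sub_le_sub_left hy _))

section Lattice

variable {E : Type u} [AddCommGroup E] [Lattice E] [IsOrderedAddMonoid E] [Module ℝ E]
  [IsOrderedModule ℝ E]
variable {F : Type v} [AddCommGroup F] [Module ℝ F]

/-- An additive and positively homogeneous map on the positive cone extends to a linear map. -/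
def coneExtend (p : E → F) (hadd : ∀ x y, 0 ≤ x → 0 ≤ y → p (x + y) = p x + p y)
    (hsmul : ∀ (r : ℝ) x, 0 ≤ r → 0 ≤ x → p (r • x) = r • p x) : E →ₗ[ℝ] F :=
  have key : ∀ x a b : E, 0 ≤ a → 0 ≤ b → x = a - b → p x⁺ - p x⁻ = p a - p b := by
    intro x a b ha hb hx
    have h1 : x⁺ + b = a + x⁻ := by
      have := posPart_sub_negPart x
      rw [hx] at this ⊢
      rw [sub_eq_sub_iff_add_eq_add] at this
      exact this
    have h2 := congrArg p h1
    rw [hadd _ _ (posPart_nonneg x) hb, hadd _ _ ha (negPart_nonneg x)] at h2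
    rw [sub_eq_sub_iff_add_eq_add]
    exact h2
  { toFun := fun x => p x⁺ - p x⁻
    map_add' := fun x y => by
      rw [key (x + y) (x⁺ + y⁺) (x⁻ + y⁻) (add_nonneg (posPart_nonneg x) (posPart_nonneg y))
        (add_nonneg (negPart_nonneg x) (negPart_nonneg y))
        (by rw [add_sub_add_comm, posPart_sub_negPart, posPart_sub_negPart]),
        hadd _ _ (posPart_nonneg x) (posPart_nonneg y),
        hadd _ _ (negPart_nonneg x) (negPart_nonneg y), add_sub_add_comm]
    map_smul' := fun r x => by
      simp only [RingHom.id_apply]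
      rcases le_total 0 r with hr | hr
      · rw [key (r • x) (r • x⁺) (r • x⁻) (smul_nonneg hr (posPart_nonneg x))
          (smul_nonneg hr (negPart_nonneg x)) (by rw [← smul_sub, posPart_sub_negPart]),
          hsmul _ _ hr (posPart_nonneg x), hsmul _ _ hr (negPart_nonneg x), smul_sub]
      · have hr' := neg_nonneg.2 hr
        rw [key (r • x) ((-r) • x⁻) ((-r) • x⁺) (smul_nonneg hr' (negPart_nonneg x))
          (smul_nonneg hr' (posPart_nonneg x))
          (by rw [← smul_sub, ← neg_sub, posPart_sub_negPart, smul_neg, neg_smul, neg_neg]),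
          hsmul _ _ hr' (posPart_nonneg x), hsmul _ _ hr' (negPart_nonneg x), ← smul_sub,
          ← neg_sub, smul_neg, neg_smul, neg_neg] }

theorem coneExtend_apply (p : E → F) (hadd : ∀ x y, 0 ≤ x → 0 ≤ y → p (x + y) = p x + p y)
    (hsmul : ∀ (r : ℝ) x, 0 ≤ r → 0 ≤ x → p (r • x) = r • p x) {x : E} (hx : 0 ≤ x) :
    coneExtend p hadd hsmul x = p x := by
  have h0 : p 0 = 0 := by simpa using hadd 0 0 le_rfl le_rfl
  change p x⁺ - p x⁻ = p x
  rw [posPart_of_nonneg hx, negPart_of_nonneg hx, h0, sub_zero]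

/-- Linear maps that agree on the positive cone are equal. -/
theorem linearMap_ext_nonneg {S T : E →ₗ[ℝ] F} (h : ∀ x, 0 ≤ x → S x = T x) : S = T := by
  ext x
  rw [← posPart_sub_negPart x, map_sub, map_sub, h _ (posPart_nonneg x), h _ (negPart_nonneg x)]

theorem posPart_smul_of_nonneg {r : ℝ} (hr : 0 ≤ r) (x : E) : (r • x)⁺ = r • x⁺ := by
  rcases hr.eq_or_lt with rfl | hr
  · simp
  · have h : r • (x ⊔ 0) = r • x ⊔ r • (0 : E) := (OrderIso.smulRight (β := E) hr).map_sup x 0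
    rw [posPart_def, posPart_def, h, smul_zero]

theorem add_inf_le_inf_add_inf {a b c : E} (ha : 0 ≤ a) (hb : 0 ≤ b) (hc : 0 ≤ c) :
    (a + b) ⊓ c ≤ a ⊓ c + b ⊓ c := by
  rw [inf_add, add_inf, add_inf]
  refine le_inf (le_inf inf_le_left ?_) (le_inf ?_ ?_)
  · exact inf_le_right.trans (le_add_of_nonneg_left ha)
  · exact inf_le_right.trans (le_add_of_nonneg_right hb)
  · exact inf_le_right.trans (le_add_of_nonneg_right hc)

end Lattice

/-! ### The order dual of a Riesz space -/

section Dual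

variable (E : Type u) [AddCommGroup E] [Lattice E] [IsOrderedAddMonoid E] [Module ℝ E]
  [IsOrderedModule ℝ E]

/-- The order bounded linear functionals. -/
def orderBoundedFunctionals : Submodule ℝ (E →ₗ[ℝ] ℝ) where
  carrier := {f | IsOrderBounded f}
  zero_mem' := IsOrderBounded.zero
  add_mem' := IsOrderBounded.add
  smul_mem' r _ hf := IsOrderBounded.smul r hf

/-- The order dual `E^~` of a Riesz space `E`: the order bounded linear functionals on `E`. -/
def RieszDual : Type u := ↥(orderBoundedFunctionals E)

namespace RieszDual

instance : AddCommGroup (RieszDual E) := inferInstanceAs (AddCommGroup ↥(orderBoundedFunctionals E))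

instance : Module ℝ (RieszDual E) := inferInstanceAs (Module ℝ ↥(orderBoundedFunctionals E))

variable {E}

instance : FunLike (RieszDual E) E ℝ where
  coe f := f.1
  coe_injective _ _ h := Subtype.ext (DFunLike.coe_injective h)

instance : LinearMapClass (RieszDual E) ℝ E ℝ where
  map_add f := f.1.map_add
  map_smulₛₗ f := f.1.map_smul

/-- An order bounded linear functional as an element of the order dual. -/
def mk (f : E →ₗ[ℝ] ℝ) (hf : IsOrderBounded f) : RieszDual E := ⟨f, hf⟩

/-- The underlying linear functional. -/
def toLin (f : RieszDual E) : E →ₗ[ℝ] ℝ := f.1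

theorem isOrderBounded (f : RieszDual E) : IsOrderBounded f.toLin := f.2

@[simp] theorem mk_apply (f : E →ₗ[ℝ] ℝ) (hf : IsOrderBounded f) (x : E) : mk f hf x = f x := rfl
@[simp] theorem toLin_apply (f : RieszDual E) (x : E) : f.toLin x = f x := rfl
@[simp] theorem add_apply (f g : RieszDual E) (x : E) : (f + g) x = f x + g x := rfl
@[simp] theorem sub_apply (f g : RieszDual E) (x : E) : (f - g) x = f x - g x := rfl
@[simp] theorem neg_apply (f : RieszDual E) (x : E) : (-f) x = -f x := rfl
@[simp] theorem zero_apply (x : E) : (0 : RieszDual E) x = 0 := rfl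
@[simp] theorem smul_apply (r : ℝ) (f : RieszDual E) (x : E) : (r • f) x = r * f x := rfl

@[ext] theorem ext {f g : RieszDual E} (h : ∀ x, f x = g x) : f = g := DFunLike.ext _ _ h

theorem ext_nonneg {f g : RieszDual E} (h : ∀ x, 0 ≤ x → f x = g x) : f = g :=
  Subtype.ext (linearMap_ext_nonneg h)

/-- The order of `E^~`: `f ≤ g` if and only if `f x ≤ g x` for all `x ≥ 0`. -/
instance : PartialOrder (RieszDual E) where
  le f g := ∀ x, 0 ≤ x → f x ≤ g x
  le_refl _ _ _ := le_rfl
  le_trans _ _ _ h h' x hx := (h x hx).trans (h' x hx)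
  le_antisymm _ _ h h' := ext_nonneg fun x hx => le_antisymm (h x hx) (h' x hx)

theorem le_def {f g : RieszDual E} : f ≤ g ↔ ∀ x, 0 ≤ x → f x ≤ g x := Iff.rfl

instance : IsOrderedAddMonoid (RieszDual E) where
  add_le_add_left f g h k x hx := by
    have := h x hx
    simpa using this

instance : IsOrderedModule ℝ (RieszDual E) where
  smul_le_smul_of_nonneg_left r hr f g h x hx := mul_le_mul_of_nonneg_left (h x hx) hr
  smul_le_smul_of_nonneg_right f hf r s h x hx := mul_le_mul_of_nonneg_right h (hf x hx)

theorem nonneg_apply {f : RieszDual E} (hf : 0 ≤ f) {x : E} (hx : 0 ≤ x) : 0 ≤ f x := hf x hx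

theorem mono {f : RieszDual E} (hf : 0 ≤ f) {x y : E} (h : x ≤ y) : f x ≤ f y := by
  have := nonneg_apply hf (sub_nonneg.2 h)
  rw [map_sub] at this
  exact sub_nonneg.1 this

/-- The value of the positive part of `f` at a positive element. -/
noncomputable def posVal (f : RieszDual E) (x : E) : ℝ := sSup (f '' Set.Icc 0 x)

theorem bddAbove_image (f : RieszDual E) (x : E) : BddAbove (f '' Set.Icc 0 x) := by
  obtain ⟨c, d, h⟩ := f.isOrderBounded 0 x
  refine ⟨d, ?_⟩
  rintro _ ⟨y, hy, rfl⟩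
  exact (h y hy).2

theorem le_posVal (f : RieszDual E) {x y : E} (hy : 0 ≤ y) (hyx : y ≤ x) : f y ≤ posVal f x :=
  le_csSup (bddAbove_image f x) ⟨y, ⟨hy, hyx⟩, rfl⟩

theorem posVal_le (f : RieszDual E) {x : E} (hx : 0 ≤ x) {r : ℝ}
    (h : ∀ y, 0 ≤ y → y ≤ x → f y ≤ r) : posVal f x ≤ r := by
  refine csSup_le ⟨f 0, 0, ⟨le_rfl, hx⟩, rfl⟩ ?_
  rintro _ ⟨y, hy, rfl⟩
  exact h y hy.1 hy.2

theorem posVal_add (f : RieszDual E) (x y : E) (hx : 0 ≤ x) (hy : 0 ≤ y) :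
    posVal f (x + y) = posVal f x + posVal f y := by
  apply le_antisymm
  · refine posVal_le f (add_nonneg hx hy) fun z hz hzxy => ?_
    have h1 := le_posVal f (le_inf hz hx) (inf_le_right : z ⊓ x ≤ x)
    have h2 := le_posVal f (x := y) (sub_nonneg.2 (inf_le_left : z ⊓ x ≤ z)) (by
      rw [sub_le_comm]
      exact le_inf (sub_le_self _ hy) (sub_le_iff_le_add.2 hzxy))
    rw [map_sub] at h2
    linarith
  · rw [← le_sub_iff_add_le]
    refine posVal_le f hx fun z hz hzx => ?_
    rw [le_sub_comm]
    refine posVal_le f hy fun t ht hty => ?_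
    have := le_posVal f (add_nonneg hz ht) (add_le_add hzx hty)
    rw [map_add] at this
    linarith

theorem posVal_smul (f : RieszDual E) (r : ℝ) (x : E) (hr : 0 ≤ r) (hx : 0 ≤ x) :
    posVal f (r • x) = r • posVal f x := by
  have key : ∀ (r : ℝ) (x : E), 0 < r → 0 ≤ x → r * posVal f x ≤ posVal f (r • x) := by
    intro r x hr hx
    rw [← le_div_iff₀' hr]
    refine posVal_le f hx fun y hy hyx => ?_
    rw [le_div_iff₀' hr]
    have := le_posVal f (smul_nonneg hr.le hy) (smul_le_smul_of_nonneg_left hyx hr.le)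
    rwa [map_smul] at this
  rcases hr.eq_or_lt with rfl | hr
  · rw [zero_smul, zero_smul]
    refine le_antisymm (posVal_le f le_rfl fun y hy hy' => ?_) ?_
    · rw [le_antisymm hy' hy, map_zero]
    · simpa using le_posVal f (le_refl (0 : E)) le_rfl
  · refine le_antisymm ?_ (key r x hr hx)
    have := key r⁻¹ (r • x) (inv_pos.2 hr) (smul_nonneg hr.le hx)
    rw [inv_smul_smul₀ hr.ne', inv_mul_le_iff₀ hr] at this
    exact this

/-- The positive part of an order bounded functional (Riesz–Kantorovich formula). -/
noncomputable def pos (f : RieszDual E) : RieszDual E :=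
  mk (coneExtend (posVal f) (posVal_add f) (posVal_smul f)) <| IsOrderBounded.of_nonneg <| by
    intro x hx
    rw [coneExtend_apply _ _ _ hx]
    simpa using le_posVal f le_rfl hx

theorem pos_apply (f : RieszDual E) {x : E} (hx : 0 ≤ x) : pos f x = posVal f x :=
  coneExtend_apply (posVal f) (posVal_add f) (posVal_smul f) hx

/-- The order dual is a Riesz space. -/
noncomputable instance : Lattice (RieszDual E) :=
  latticeOfPosPart pos
    (fun f x hx => by rw [pos_apply f hx]; simpa using le_posVal f le_rfl hx)
    (fun f x hx => by rw [pos_apply f hx]; exact le_posVal f hx le_rfl)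
    (fun f g hg hfg x hx => by
      rw [pos_apply f hx]
      exact posVal_le f hx fun y hy hyx => (hfg y hy).trans (mono hg hyx))

theorem posPart_apply (f : RieszDual E) {x : E} (hx : 0 ≤ x) :
    f⁺ x = sSup (f '' Set.Icc 0 x) := by
  change (pos (f - 0) + 0) x = _
  rw [sub_zero, add_zero]
  exact pos_apply f hx

end RieszDual

variable {E} in
theorem RieszDual.eq_sub (f : RieszDual E) : f = f⁺ - f⁻ := (posPart_sub_negPart f).symm

end Dual

/-! ### Order bounded operators, bands and orthomorphisms -/

section Operators

variable (E : Type u) [AddCommGroup E] [Lattice E] [IsOrderedAddMonoid E] [Module ℝ E]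
  [IsOrderedModule ℝ E]

/-- The algebra `L_b(E)` of order bounded linear operators on a Riesz space `E`. -/
def Lb : Subalgebra ℝ (Module.End ℝ E) where
  carrier := {T | IsOrderBounded T}
  mul_mem' hS hT := IsOrderBounded.comp hS hT
  one_mem' := IsOrderBounded.of_nonneg fun _ hx => hx
  add_mem' hS hT := IsOrderBounded.add hS hT
  zero_mem' := IsOrderBounded.zero
  algebraMap_mem' r := by
    have h : IsOrderBounded (1 : Module.End ℝ E) := IsOrderBounded.of_nonneg fun _ hx => hx
    rw [Algebra.algebraMap_eq_smul_one]
    exact h.smul r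

/-- A band of a Riesz space: a solid linear subspace (an order ideal) that contains the supremum
of each of its subsets that has a supremum. -/
structure IsBand {E : Type u} [AddCommGroup E] [Lattice E] [Module ℝ E]
    (B : Submodule ℝ E) : Prop where
  solid : LatticeOrderedAddCommGroup.IsSolid (B : Set E)
  sup_mem : ∀ D : Set E, D ⊆ B → D.Nonempty → ∀ s : E, IsLUB D s → s ∈ B

/-- The algebra `Orth(E)` of orthomorphisms: the order bounded linear operators on `E` that
leave every band of `E` invariant. -/
def Orth : Subalgebra ℝ (Module.End ℝ E) where
  carrier := {T | IsOrderBounded T ∧ ∀ B : Submodule ℝ E, IsBand B → ∀ x ∈ B, T x ∈ B}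
  mul_mem' hS hT := ⟨hS.1.comp hT.1, fun B hB x hx => hS.2 B hB _ (hT.2 B hB x hx)⟩
  one_mem' := ⟨(Lb E).one_mem, fun _ _ _ hx => hx⟩
  add_mem' hS hT := ⟨hS.1.add hT.1, fun B hB x hx => B.add_mem (hS.2 B hB x hx) (hT.2 B hB x hx)⟩
  zero_mem' := ⟨IsOrderBounded.zero, fun B _ _ _ => B.zero_mem⟩
  algebraMap_mem' r := ⟨(Lb E).algebraMap_mem r, fun B _ x hx => by
    simpa [Module.algebraMap_end_apply] using B.smul_mem r hx⟩

variable {E}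

/-- The order of `L_b(E)`: `S ≤ T` if and only if `S x ≤ T x` for all `x ≥ 0`. -/
instance : PartialOrder ↥(Lb E) where
  le S T := ∀ x, 0 ≤ x → S.1 x ≤ T.1 x
  le_refl _ _ _ := le_rfl
  le_trans _ _ _ h h' x hx := (h x hx).trans (h' x hx)
  le_antisymm _ _ h h' := Subtype.ext <| linearMap_ext_nonneg fun x hx =>
    le_antisymm (h x hx) (h' x hx)

instance : IsOrderedAddMonoid ↥(Lb E) where
  add_le_add_left S T h R x hx := add_le_add_left (h x hx) (R.1 x)

namespace Orth

/-- The order of `Orth(E)`: `S ≤ T` if and only if `S x ≤ T x` for all `x ≥ 0`. -/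
instance : PartialOrder ↥(Orth E) where
  le S T := ∀ x, 0 ≤ x → S.1 x ≤ T.1 x
  le_refl _ _ _ := le_rfl
  le_trans _ _ _ h h' x hx := (h x hx).trans (h' x hx)
  le_antisymm _ _ h h' := Subtype.ext <| linearMap_ext_nonneg fun x hx =>
    le_antisymm (h x hx) (h' x hx)

theorem le_def {S T : ↥(Orth E)} : S ≤ T ↔ ∀ x, 0 ≤ x → S.1 x ≤ T.1 x := Iff.rfl

theorem nonneg_apply {S : ↥(Orth E)} (hS : 0 ≤ S) {x : E} (hx : 0 ≤ x) : 0 ≤ S.1 x := hS x hx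

theorem mono {S : ↥(Orth E)} (hS : 0 ≤ S) {x y : E} (h : x ≤ y) : S.1 x ≤ S.1 y := by
  have := nonneg_apply hS (sub_nonneg.2 h)
  rw [map_sub] at this
  exact sub_nonneg.1 this

instance instIsOrderedAddMonoid : IsOrderedAddMonoid ↥(Orth E) where
  add_le_add_left S T h R x hx := add_le_add_left (h x hx) (R.1 x)

instance : IsOrderedRing ↥(Orth E) where
  zero_le_one x hx := hx
  mul_le_mul_of_nonneg_left R hR S T h x hx := mono hR (h x hx)
  mul_le_mul_of_nonneg_right R hR S T h x hx := h _ (nonneg_apply hR hx)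

instance : IsOrderedModule ℝ ↥(Orth E) where
  smul_le_smul_of_nonneg_left r hr S T h x hx := smul_le_smul_of_nonneg_left (h x hx) hr
  smul_le_smul_of_nonneg_right S hS r s h x hx := smul_le_smul_of_nonneg_right h (hS x hx)

end Orth

end Operators

/-! ### Disjointness and the lattice structure of `Orth(E)` -/

section Disjointness

variable {E : Type u} [AddCommGroup E] [Lattice E] [IsOrderedAddMonoid E] [Module ℝ E]
  [IsOrderedModule ℝ E]

theorem abs_smul_inf_eq_zero {x y : E} (h : |x| ⊓ y = 0) (hy : 0 ≤ y) (r : ℝ) :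
    |r • x| ⊓ y = 0 := by
  have nat : ∀ n : ℕ, ((n : ℝ) • |x|) ⊓ y ≤ 0 := by
    intro n
    induction n with
    | zero => simp
    | succ n ih =>
      push_cast
      rw [add_smul, one_smul]
      refine (add_inf_le_inf_add_inf (smul_nonneg n.cast_nonneg (abs_nonneg x)) (abs_nonneg x)
        hy).trans ?_
      rw [h, add_zero]
      exact ih
  obtain ⟨n, hn⟩ := exists_nat_ge |r|
  refine le_antisymm (le_trans (inf_le_inf_right y ?_) (nat n)) (le_inf (abs_nonneg _) hy)
  refine le_trans ?_ (smul_le_smul_of_nonneg_right hn (abs_nonneg x))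
  refine abs_le'.2 ⟨?_, ?_⟩
  · rcases le_total 0 r with hr | hr
    · rw [abs_of_nonneg hr]
      exact smul_le_smul_of_nonneg_left (le_abs_self x) hr
    · rw [abs_of_nonpos hr, ← neg_neg x, smul_neg, ← neg_smul, abs_neg]
      exact smul_le_smul_of_nonneg_left (le_abs_self _) (neg_nonneg.2 hr)
  · rcases le_total 0 r with hr | hr
    · rw [abs_of_nonneg hr, ← smul_neg]
      exact smul_le_smul_of_nonneg_left (neg_le_abs x) hr
    · rw [abs_of_nonpos hr, ← neg_smul]
      exact smul_le_smul_of_nonneg_left (le_abs_self _) (neg_nonneg.2 hr)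

/-- The disjoint complement of a positive element. -/
def disjointComplement (y : E) (hy : 0 ≤ y) : Submodule ℝ E where
  carrier := {x | |x| ⊓ y = 0}
  zero_mem' := by simp [hy]
  add_mem' := by
    intro a b ha hb
    have ha' : |a| ⊓ y = 0 := ha
    have hb' : |b| ⊓ y = 0 := hb
    refine le_antisymm ?_ (le_inf (abs_nonneg _) hy)
    refine (inf_le_inf_right y (abs_add_le a b)).trans ?_
    refine (add_inf_le_inf_add_inf (abs_nonneg a) (abs_nonneg b) hy).trans ?_
    rw [ha', hb', add_zero]
  smul_mem' r x hx := abs_smul_inf_eq_zero hx hy r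

theorem mem_disjointComplement {y : E} (hy : 0 ≤ y) {x : E} :
    x ∈ disjointComplement y hy ↔ |x| ⊓ y = 0 := Iff.rfl

theorem mem_disjointComplement_of_abs_le {y : E} (hy : 0 ≤ y) {x z : E}
    (hx : x ∈ disjointComplement y hy) (h : |z| ≤ |x|) : z ∈ disjointComplement y hy :=
  le_antisymm ((inf_le_inf_right y h).trans (le_of_eq hx)) (le_inf (abs_nonneg _) hy)

theorem isBand_disjointComplement (y : E) (hy : 0 ≤ y) : IsBand (disjointComplement y hy) where
  solid x hx z hz := mem_disjointComplement_of_abs_le hy hx hz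
  sup_mem D hD hne s hs := by
    obtain ⟨d, hd⟩ := hne
    have hneg : s⁻ ∈ disjointComplement y hy := by
      refine mem_disjointComplement_of_abs_le hy (hD hd) ?_
      rw [abs_of_nonneg (negPart_nonneg s)]
      refine (negPart_anti (hs.1 hd)).trans ?_
      rw [← posPart_add_negPart]
      exact le_add_of_nonneg_left (posPart_nonneg d)
    have hpos : s⁺ ∈ disjointComplement y hy := by
      rw [mem_disjointComplement, abs_of_nonneg (posPart_nonneg s)]
      set t := s⁺ ⊓ y with ht
      have ht0 : 0 ≤ t := le_inf (posPart_nonneg s) hy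
      have hub : s ≤ s⁺ - t := by
        refine hs.2 fun e he => ?_
        have h1 : e⁺ ⊓ y = 0 := by
          have : e⁺ ∈ disjointComplement y hy := by
            refine mem_disjointComplement_of_abs_le hy (hD he) ?_
            rw [abs_of_nonneg (posPart_nonneg e), ← posPart_add_negPart]
            exact le_add_of_nonneg_right (negPart_nonneg e)
          simpa [mem_disjointComplement, abs_of_nonneg (posPart_nonneg e)] using this
        have h2 : e⁺ ⊓ t = 0 :=
          le_antisymm ((inf_le_inf_left _ inf_le_right).trans h1.le)
            (le_inf (posPart_nonneg e) ht0)
        have h3 : e⁺ + t ≤ s⁺ := by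
          rw [← inf_add_sup e⁺ t, h2, zero_add]
          exact sup_le (posPart_mono (hs.1 he)) inf_le_left
        exact (le_posPart e).trans (le_sub_iff_add_le.2 h3)
      have h4 : s⁺ ≤ s⁺ - t := by
        rw [posPart_def]
        refine sup_le hub (sub_nonneg.2 inf_le_left)
      have h5 : t ≤ 0 := by simpa using h4
      exact le_antisymm h5 ht0
    rw [← posPart_sub_negPart s]
    exact Submodule.sub_mem _ hpos hneg

theorem Orth.disjoint_apply (T : ↥(Orth E)) {x y : E} (hy : 0 ≤ y) (h : |x| ⊓ y = 0) :
    |T.1 x| ⊓ y = 0 :=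
  T.2.2 _ (isBand_disjointComplement y hy) x h

theorem inf_negPart_le (α β : E) {t : ℝ} (ht : 0 ≤ t) : α⁺ ⊓ β⁻ ≤ |α - t • β| := by
  set d := |α - t • β| with hd
  have hd0 : 0 ≤ d := abs_nonneg _
  have hb0 : 0 ≤ t • β⁺ := smul_nonneg ht (posPart_nonneg β)
  have h1 : α⁺ ≤ d + t • β⁺ := by
    rw [posPart_def]
    refine sup_le ?_ (add_nonneg hd0 hb0)
    rw [← sub_le_iff_le_add]
    refine le_trans (sub_le_sub_left ?_ α) (le_abs_self _)
    exact smul_le_smul_of_nonneg_left (le_posPart β) ht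
  have h2 : (t • β⁺) ⊓ β⁻ = 0 := by
    have := abs_smul_inf_eq_zero (x := β⁺) (y := β⁻)
      (by rw [abs_of_nonneg (posPart_nonneg β)]; exact posPart_inf_negPart_eq_zero β)
      (negPart_nonneg β) t
    rwa [abs_of_nonneg hb0] at this
  calc α⁺ ⊓ β⁻ ≤ (d + t • β⁺) ⊓ β⁻ := inf_le_inf_right _ h1
    _ ≤ d ⊓ β⁻ + (t • β⁺) ⊓ β⁻ := add_inf_le_inf_add_inf hd0 hb0 (negPart_nonneg β)
    _ ≤ d := by rw [h2, add_zero]; exact inf_le_left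

/-- A Riesz space has separating order dual if the order bounded functionals separate its
points. -/
class HasSeparatingOrderDual (E : Type u) [AddCommGroup E] [Lattice E] [IsOrderedAddMonoid E]
    [Module ℝ E] [IsOrderedModule ℝ E] : Prop where
  separates : ∀ x : E, x ≠ 0 → ∃ f : RieszDual E, f x ≠ 0

/-- A Riesz space with separating order dual is Archimedean. -/
theorem eq_zero_of_nsmul_le [HasSeparatingOrderDual E] {x y : E} (hx : 0 ≤ x)
    (h : ∀ n : ℕ, (n : ℝ) • x ≤ y) : x = 0 := by
  by_contra hne
  have key : ∀ f : RieszDual E, 0 ≤ f → f x = 0 := by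
    intro f hf
    have h0 := RieszDual.nonneg_apply hf hx
    refine le_antisymm ?_ h0
    by_contra hpos
    push Not at hpos
    obtain ⟨n, hn⟩ := exists_nat_gt (f y / f x)
    have := RieszDual.mono hf (h n)
    rw [map_smul, smul_eq_mul] at this
    rw [div_lt_iff₀ hpos] at hn
    linarith
  obtain ⟨f, hf⟩ := HasSeparatingOrderDual.separates x hne
  apply hf
  rw [f.eq_sub, RieszDual.sub_apply, key _ (posPart_nonneg f), key _ (negPart_nonneg f), sub_zero]

theorem posPart_sub_inf (z b : E) (hb : 0 ≤ b) : z⁺ - z⁺ ⊓ b = (z - b)⁺ := by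
  rw [inf_eq_sub_posPart_sub, sub_sub_cancel]
  apply le_antisymm
  · rw [posPart_def (z⁺ - b), posPart_def z, sup_sub]
    refine sup_le (sup_le (le_posPart _) ?_) (posPart_nonneg _)
    exact (sub_nonpos.2 hb).trans (posPart_nonneg _)
  · exact posPart_mono (sub_le_sub_right (le_posPart z) b)

/-- The values of an orthomorphism at two positive elements have the same sign. -/
theorem Orth.posPart_inf_negPart [HasSeparatingOrderDual E] (T : ↥(Orth E)) {x y : E}
    (hx : 0 ≤ x) (hy : 0 ≤ y) : (T.1 x)⁺ ⊓ (T.1 y)⁻ = 0 := by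
  obtain ⟨c, d, hcd⟩ := T.2.1 0 y
  set U : E := |c| + |d| with hU
  have hU0 : 0 ≤ U := add_nonneg (abs_nonneg c) (abs_nonneg d)
  have hbound : ∀ s, 0 ≤ s → s ≤ y → |T.1 s| ≤ U := by
    intro s hs hsy
    obtain ⟨h1, h2⟩ := hcd s ⟨hs, hsy⟩
    refine abs_le'.2 ⟨h2.trans ((le_abs_self d).trans (le_add_of_nonneg_left (abs_nonneg c))), ?_⟩
    exact (neg_le_neg h1).trans ((neg_le_abs c).trans (le_add_of_nonneg_right (abs_nonneg d)))
  set a : E := (T.1 x)⁺ ⊓ (T.1 y)⁻ with ha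
  have ha0 : 0 ≤ a := le_inf (posPart_nonneg _) (negPart_nonneg _)
  have hax : a ≤ |T.1 x| := by
    refine inf_le_left.trans ?_
    rw [← posPart_add_negPart]
    exact le_add_of_nonneg_right (negPart_nonneg _)
  have hay : a ≤ |T.1 y| := by
    refine inf_le_right.trans ?_
    rw [← posPart_add_negPart]
    exact le_add_of_nonneg_left (posPart_nonneg _)
  -- it suffices to bound `a` by arbitrarily small multiples of `U`
  have main : ∀ n : ℕ, 0 < n → a ≤ ((n : ℝ)⁻¹) • U := by
    intro n hn
    set ε : ℝ := (n : ℝ)⁻¹ with hε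
    have hε0 : 0 < ε := by positivity
    set r : E := (a - ε • U)⁺ with hr
    have hr0 : 0 ≤ r := posPart_nonneg _
    have hεU : 0 ≤ ε • U := smul_nonneg hε0.le hU0
    have hra : r ≤ a := by
      rw [hr, posPart_def]
      exact sup_le (sub_le_self _ hεU) ha0
    have step : ∀ k : ℕ, r ⊓ (x - ((k : ℝ) * ε) • y)⁻ = 0 := by
      intro k
      induction k with
      | zero =>
        simp only [Nat.cast_zero, zero_mul, zero_smul, sub_zero]
        rw [negPart_of_nonneg hx]
        exact inf_eq_right.2 hr0
      | succ k ih =>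
        set t : ℝ := (k : ℝ) * ε with ht
        have ht0 : 0 ≤ t := by positivity
        set z : E := x - t • y with hz
        have hz' : x - ((k + 1 : ℕ) * ε) • y = z - ε • y := by
          rw [hz, ht]
          push_cast
          rw [add_mul, one_mul, add_smul, sub_sub]
        rw [hz']
        set q : E := r ⊓ (z - ε • y)⁻ with hq
        have hq0 : 0 ≤ q := le_inf hr0 (negPart_nonneg _)
        have hεy : 0 ≤ ε • y := smul_nonneg hε0.le hy
        set m : E := z⁺ ⊓ (ε • y) with hm
        have hm0 : 0 ≤ m := le_inf (posPart_nonneg _) hεy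
        have hTm : |T.1 m| ≤ ε • U := by
          have hs := hbound (ε⁻¹ • m) (smul_nonneg (inv_pos.2 hε0).le hm0) (by
            have := smul_le_smul_of_nonneg_left (inf_le_right : m ≤ ε • y) (inv_pos.2 hε0).le
            rwa [inv_smul_smul₀ hε0.ne'] at this)
          have hmm : T.1 m = ε • T.1 (ε⁻¹ • m) := by
            rw [map_smul, smul_inv_smul₀ hε0.ne']
          rw [hmm]
          refine abs_le'.2 ⟨?_, ?_⟩
          · exact smul_le_smul_of_nonneg_left ((le_abs_self _).trans hs) hε0.le
          · rw [← smul_neg]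
            exact smul_le_smul_of_nonneg_left ((neg_le_abs _).trans hs) hε0.le
        have hdec : z = m + ((z - ε • y)⁺ - z⁻) := by
          rw [← posPart_sub_inf z _ hεy]
          conv_lhs => rw [← posPart_sub_negPart z]
          abel
        have hD : (z - ε • y)⁺ - z⁻ ∈ disjointComplement q hq0 := by
          refine Submodule.sub_mem _ ?_ ?_
          · rw [mem_disjointComplement, abs_of_nonneg (posPart_nonneg _)]
            refine le_antisymm ?_ (le_inf (posPart_nonneg _) hq0)
            exact (inf_le_inf_left _ inf_le_right).trans (posPart_inf_negPart_eq_zero _).le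
          · rw [mem_disjointComplement, abs_of_nonneg (negPart_nonneg _)]
            refine le_antisymm ?_ (le_inf (negPart_nonneg _) hq0)
            rw [inf_comm]
            exact (inf_le_inf_right _ inf_le_left).trans ih.le
        have hTD := Orth.disjoint_apply T hq0 hD
        set D : E := (z - ε • y)⁺ - z⁻ with hDdef
        have h1 : a ≤ |T.1 D| + ε • U := by
          refine (inf_negPart_le (T.1 x) (T.1 y) ht0).trans ?_
          have h2 : T.1 x - t • T.1 y = T.1 D + T.1 m := by
            rw [← map_smul, ← map_sub, ← hz, ← map_add, add_comm D m, ← hdec]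
          rw [h2]
          exact (abs_add_le _ _).trans (add_le_add_right hTm _)
        have h3 : r ≤ |T.1 D| := by
          rw [hr, posPart_def]
          exact sup_le (sub_le_iff_le_add.2 h1) (abs_nonneg _)
        refine le_antisymm ?_ hq0
        rw [← hTD]
        exact le_inf (inf_le_left.trans h3) le_rfl
    -- `r` is disjoint from `x ⊓ y`
    have hrxy : r ⊓ (x ⊓ y) = 0 := by
      set w : E := r ⊓ (x ⊓ y) with hw
      have hw0 : 0 ≤ w := le_inf hr0 (le_inf hx hy)
      refine eq_zero_of_nsmul_le (y := (n : ℝ) • x) hw0 fun k => ?_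
      set s : ℝ := (k : ℝ) * ε with hs
      have hs0 : 0 ≤ s := by positivity
      have h1 : s • w ≤ x := by
        have h2 : |s • w| ⊓ (x - s • y)⁻ = 0 := by
          refine abs_smul_inf_eq_zero ?_ (negPart_nonneg _) s
          rw [abs_of_nonneg hw0]
          refine le_antisymm ?_ (le_inf hw0 (negPart_nonneg _))
          exact (inf_le_inf_right _ inf_le_left).trans (step k).le
        rw [abs_of_nonneg (smul_nonneg hs0 hw0)] at h2
        have h3 : s • w ≤ (x - s • y)⁻ + x := by
          have h4 : s • w ≤ s • y :=
            smul_le_smul_of_nonneg_left (inf_le_right.trans inf_le_right) hs0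
          refine h4.trans ?_
          rw [← sub_le_iff_le_add, ← neg_sub]
          exact neg_le_negPart _
        calc s • w = ((x - s • y)⁻ + x) ⊓ (s • w) := (inf_eq_right.2 h3).symm
          _ ≤ (x - s • y)⁻ ⊓ (s • w) + x ⊓ (s • w) :=
            add_inf_le_inf_add_inf (negPart_nonneg _) hx (smul_nonneg hs0 hw0)
          _ ≤ x := by rw [inf_comm, h2, zero_add]; exact inf_le_left
      have h5 := smul_le_smul_of_nonneg_left h1 (Nat.cast_nonneg n : (0 : ℝ) ≤ n)
      rw [smul_smul, hs, hε] at h5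
      have hn' : (n : ℝ) ≠ 0 := by positivity
      rwa [mul_comm (k : ℝ), mul_inv_cancel_left₀ hn'] at h5
    -- hence `r = 0`
    have h1 : r ⊓ x = 0 := by
      have hrx0 : 0 ≤ r ⊓ x := le_inf hr0 hx
      have h2 := Orth.disjoint_apply T (x := y) hrx0 (by
        rw [abs_of_nonneg hy, inf_comm, inf_assoc]
        exact hrxy)
      refine le_antisymm ?_ hrx0
      rw [← h2]
      exact le_inf (inf_le_left.trans (hra.trans hay)) le_rfl
    have h2 : r = 0 := by
      have h3 := Orth.disjoint_apply T (x := x) hr0 (by rw [abs_of_nonneg hx, inf_comm]; exact h1)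
      refine le_antisymm ?_ hr0
      rw [← h3]
      exact le_inf (hra.trans hax) le_rfl
    have h4 : a - ε • U ≤ 0 := (le_posPart _).trans h2.le
    exact sub_nonpos.1 h4
  refine eq_zero_of_nsmul_le (y := U) ha0 fun n => ?_
  rcases Nat.eq_zero_or_pos n with rfl | hn
  · simpa using hU0
  · have h := smul_le_smul_of_nonneg_left (main n hn) (Nat.cast_nonneg n : (0 : ℝ) ≤ n)
    have hn' : (n : ℝ) ≠ 0 := by positivity
    rwa [smul_inv_smul₀ hn'] at h

theorem posPart_add_of_disjoint {a b : E} (h1 : a⁺ ⊓ b⁻ = 0) (h2 : b⁺ ⊓ a⁻ = 0) :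
    (a + b)⁺ = a⁺ + b⁺ := by
  have h3 : (a⁺ + b⁺) ⊓ (a⁻ + b⁻) = 0 := by
    have pa := posPart_nonneg a
    have pb := posPart_nonneg b
    have na := negPart_nonneg a
    have nb := negPart_nonneg b
    refine le_antisymm ?_ (le_inf (add_nonneg pa pb) (add_nonneg na nb))
    refine (add_inf_le_inf_add_inf pa pb (add_nonneg na nb)).trans ?_
    have h4 : a⁺ ⊓ (a⁻ + b⁻) ≤ 0 := by
      rw [inf_comm]
      refine (add_inf_le_inf_add_inf na nb pa).trans ?_
      rw [inf_comm, posPart_inf_negPart_eq_zero, inf_comm, h1, add_zero]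
    have h5 : b⁺ ⊓ (a⁻ + b⁻) ≤ 0 := by
      rw [inf_comm]
      refine (add_inf_le_inf_add_inf na nb pb).trans ?_
      rw [inf_comm, h2, inf_comm, posPart_inf_negPart_eq_zero, add_zero]
    exact (add_le_add h4 h5).trans (by rw [add_zero])
  have h6 : a + b = (a⁺ + b⁺) - (a⁻ + b⁻) := by
    rw [add_sub_add_comm, posPart_sub_negPart, posPart_sub_negPart]
  rw [h6]
  have h7 := inf_eq_sub_posPart_sub (a⁺ + b⁺) (a⁻ + b⁻)
  rw [h3] at h7
  exact (sub_eq_zero.1 h7.symm).symm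

namespace Orth

variable [HasSeparatingOrderDual E]

theorem posPart_map_add (T : ↥(Orth E)) (x y : E) (hx : 0 ≤ x) (hy : 0 ≤ y) :
    (T.1 (x + y))⁺ = (T.1 x)⁺ + (T.1 y)⁺ := by
  rw [map_add]
  exact posPart_add_of_disjoint (posPart_inf_negPart T hx hy) (posPart_inf_negPart T hy hx)

theorem posPart_map_smul (T : ↥(Orth E)) (r : ℝ) (x : E) (hr : 0 ≤ r) (_ : 0 ≤ x) :
    (T.1 (r • x))⁺ = r • (T.1 x)⁺ := by
  rw [map_smul]
  exact posPart_smul_of_nonneg hr _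

/-- The positive part of an orthomorphism: `T⁺ x = (T x)⁺` for `x ≥ 0`. -/
def pos (T : ↥(Orth E)) : ↥(Orth E) :=
  ⟨coneExtend (fun x => (T.1 x)⁺) (posPart_map_add T) (posPart_map_smul T),
  IsOrderBounded.of_nonneg fun x hx => by
    rw [coneExtend_apply _ _ _ hx]
    exact posPart_nonneg _,
  fun B hB x hx => by
    have hpos : ∀ z : E, z ∈ B → z⁺ ∈ B := fun z hz => hB.solid hz (by
      rw [abs_of_nonneg (posPart_nonneg z), ← posPart_add_negPart z]
      exact le_add_of_nonneg_right (negPart_nonneg z))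
    have hneg : x⁻ ∈ B := by
      have := hpos (-x) (B.neg_mem hx)
      rwa [posPart_neg] at this
    exact B.sub_mem (hpos _ (T.2.2 B hB _ (hpos _ hx))) (hpos _ (T.2.2 B hB _ hneg))⟩

theorem pos_apply (T : ↥(Orth E)) {x : E} (hx : 0 ≤ x) : (pos T).1 x = (T.1 x)⁺ :=
  coneExtend_apply _ (posPart_map_add T) (posPart_map_smul T) hx

/-- The orthomorphisms form a Riesz space. -/
instance : Lattice ↥(Orth E) :=
  latticeOfPosPart pos
    (fun T x hx => by rw [pos_apply T hx]; exact posPart_nonneg _)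
    (fun T x hx => by rw [pos_apply T hx]; exact le_posPart _)
    (fun T S hS h x hx => by
      rw [pos_apply T hx, posPart_def]
      exact sup_le (h x hx) (hS x hx))

end Orth

end Disjointness

/-! ### Order convergence, order continuity, Riesz homomorphisms -/

section OrderContinuity

/-- A net `x` in an ordered vector space order converges to `0` if there is a decreasing net `y`
with the same index set and with infimum `0` such that `-y i ≤ x i ≤ y i` (in a Riesz space:
`|x i| ≤ y i`) for all `i`. -/
def OrderTendstoZero {E : Type u} [AddCommGroup E] [PartialOrder E] {ι : Type v} [Preorder ι]
    (x : ι → E) : Prop :=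
  ∃ y : ι → E, Antitone y ∧ IsGLB (Set.range y) 0 ∧ ∀ i, -y i ≤ x i ∧ x i ≤ y i

/-- A linear map is order continuous if it maps nets that order converge to `0` to nets that order
converge to `0`. -/
def IsOrderContinuous {E : Type u} [AddCommGroup E] [PartialOrder E] [Module ℝ E]
    {F : Type v} [AddCommGroup F] [PartialOrder F] [Module ℝ F] (T : E →ₗ[ℝ] F) : Prop :=
  ∀ (ι : Type u) [Preorder ι] [IsDirectedOrder ι] [Nonempty ι] (x : ι → E),
    OrderTendstoZero x → OrderTendstoZero fun i => T (x i)

/-- A linear map `T` is a Riesz homomorphism if `T (x ⊔ y) = T x ⊔ T y` for all `x`, `y` (it is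
part of the definition that both suprema exist). -/
def IsRieszHom {E : Type u} [AddCommGroup E] [PartialOrder E] [Module ℝ E]
    {F : Type v} [AddCommGroup F] [PartialOrder F] [Module ℝ F] (T : E →ₗ[ℝ] F) : Prop :=
  ∀ x y : E, ∃ s : E, IsLUB {x, y} s ∧ IsLUB {T x, T y} (T s)

variable {E : Type u} [AddCommGroup E] [PartialOrder E] [IsOrderedAddMonoid E]
variable {ι : Type v} [Preorder ι]

theorem OrderTendstoZero.zero [Nonempty ι] : OrderTendstoZero (fun _ : ι => (0 : E)) :=
  ⟨fun _ => 0, fun _ _ _ => le_rfl, by simp, fun _ => by simp⟩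

theorem OrderTendstoZero.add [IsDirectedOrder ι] {x x' : ι → E} (h : OrderTendstoZero x)
    (h' : OrderTendstoZero x') : OrderTendstoZero fun i => x i + x' i := by
  obtain ⟨y, hy, hg, hb⟩ := h
  obtain ⟨y', hy', hg', hb'⟩ := h'
  refine ⟨fun i => y i + y' i, fun i j hij => add_le_add (hy hij) (hy' hij), ⟨?_, ?_⟩, fun i => ?_⟩
  · rintro _ ⟨i, rfl⟩
    exact add_nonneg (hg.1 ⟨i, rfl⟩) (hg'.1 ⟨i, rfl⟩)
  · intro z hz
    refine hg.2 ?_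
    rintro _ ⟨i, rfl⟩
    rw [← sub_nonpos]
    refine hg'.2 ?_
    rintro _ ⟨j, rfl⟩
    obtain ⟨k, hik, hjk⟩ := exists_ge_ge i j
    rw [sub_le_iff_le_add']
    exact (hz ⟨k, rfl⟩).trans (add_le_add (hy hik) (hy' hjk))
  · rw [neg_add]
    exact ⟨add_le_add (hb i).1 (hb' i).1, add_le_add (hb i).2 (hb' i).2⟩

theorem OrderTendstoZero.neg {x : ι → E} (h : OrderTendstoZero x) :
    OrderTendstoZero fun i => -x i := by
  obtain ⟨y, hy, hg, hb⟩ := h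
  exact ⟨y, hy, hg, fun i => ⟨neg_le_neg (hb i).2, neg_le.1 (hb i).1⟩⟩

theorem OrderTendstoZero.smul [Nonempty ι] [Module ℝ E] [IsOrderedModule ℝ E] (r : ℝ) {x : ι → E}
    (h : OrderTendstoZero x) : OrderTendstoZero fun i => r • x i := by
  have key : ∀ r : ℝ, 0 < r → OrderTendstoZero fun i => r • x i := by
    intro r hr
    obtain ⟨y, hy, hg, hb⟩ := h
    refine ⟨fun i => r • y i, fun i j hij => smul_le_smul_of_nonneg_left (hy hij) hr.le,
      ⟨?_, ?_⟩, fun i => ⟨?_, smul_le_smul_of_nonneg_left (hb i).2 hr.le⟩⟩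
    · rintro _ ⟨i, rfl⟩
      exact smul_nonneg hr.le (hg.1 ⟨i, rfl⟩)
    · intro z hz
      have h1 : r⁻¹ • z ≤ 0 := by
        refine hg.2 ?_
        rintro _ ⟨i, rfl⟩
        have h2 := smul_le_smul_of_nonneg_left (hz ⟨i, rfl⟩) (inv_pos.2 hr).le
        rwa [inv_smul_smul₀ hr.ne'] at h2
      have h2 := smul_le_smul_of_nonneg_left h1 hr.le
      rwa [smul_inv_smul₀ hr.ne', smul_zero] at h2
    · rw [← smul_neg]
      exact smul_le_smul_of_nonneg_left (hb i).1 hr.le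
  rcases lt_trichotomy r 0 with hr | rfl | hr
  · have := (key (-r) (neg_pos.2 hr)).neg
    simpa using this
  · simpa using OrderTendstoZero.zero (E := E) (ι := ι)
  · exact key r hr

theorem OrderTendstoZero.of_antitone {y : ι → E} (hy : Antitone y)
    (hg : IsGLB (Set.range y) 0) : OrderTendstoZero y :=
  ⟨y, hy, hg, fun i => by
    have h0 : 0 ≤ y i := hg.1 ⟨i, rfl⟩
    exact ⟨(neg_nonpos.2 h0).trans h0, le_rfl⟩⟩

end OrderContinuity

section OrderContinuousDual

variable (E : Type u) [AddCommGroup E] [Lattice E] [IsOrderedAddMonoid E] [Module ℝ E]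
  [IsOrderedModule ℝ E]

/-- The order continuous dual `E_n^~`: the order continuous functionals in `E^~`. -/
def OrderContinuousDual : Submodule ℝ (RieszDual E) where
  carrier := {f | IsOrderContinuous f.toLin}
  zero_mem' := fun ι _ _ _ _ _ => OrderTendstoZero.zero
  add_mem' := fun hf hg ι _ _ _ x hx => (hf ι x hx).add (hg ι x hx)
  smul_mem' := fun r _ hf ι _ _ _ x hx => (hf ι x hx).smul r

variable {E}
variable {ι : Type v} [Preorder ι] [IsDirectedOrder ι] [Nonempty ι]

/-- The infimum of a decreasing net in the order dual is computed pointwise. -/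
theorem RieszDual.isGLB_apply {y : ι → RieszDual E} (hy : Antitone y)
    (hg : IsGLB (Set.range y) 0) {x : E} (hx : 0 ≤ x) : IsGLB (Set.range fun i => y i x) 0 := by
  have hnn : ∀ i, 0 ≤ y i := fun i => hg.1 ⟨i, rfl⟩
  set p : E → ℝ := fun x => ⨅ i, y i x with hp
  have hbdd : ∀ x, 0 ≤ x → BddBelow (Set.range fun i => y i x) := fun x hx =>
    ⟨0, by rintro _ ⟨i, rfl⟩; exact hnn i x hx⟩
  have hple : ∀ x, 0 ≤ x → ∀ i, p x ≤ y i x := fun x hx i => ciInf_le (hbdd x hx) i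
  have hadd : ∀ x z, 0 ≤ x → 0 ≤ z → p (x + z) = p x + p z := by
    intro x z hx hz
    apply le_antisymm
    · rw [← sub_le_iff_le_add]
      refine le_ciInf fun i => ?_
      rw [sub_le_comm]
      refine le_ciInf fun j => ?_
      obtain ⟨k, hik, hjk⟩ := exists_ge_ge i j
      have h1 := hple (x + z) (add_nonneg hx hz) k
      rw [map_add] at h1
      have h2 := hy hik x hx
      have h3 := hy hjk z hz
      linarith
    · refine le_ciInf fun i => ?_
      rw [map_add]
      exact add_le_add (hple x hx i) (hple z hz i)
  have hsmul : ∀ (r : ℝ) x, 0 ≤ r → 0 ≤ x → p (r • x) = r • p x := by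
    intro r x hr hx
    simp only [hp, map_smul, smul_eq_mul]
    exact (Real.mul_iInf_of_nonneg hr _).symm
  have hpnn : ∀ x, 0 ≤ x → 0 ≤ coneExtend p hadd hsmul x := fun x hx => by
    rw [coneExtend_apply p hadd hsmul hx]
    exact le_ciInf fun i => hnn i x hx
  set P : RieszDual E := RieszDual.mk (coneExtend p hadd hsmul) (IsOrderBounded.of_nonneg hpnn)
  have hP : P ≤ 0 := by
    refine hg.2 ?_
    rintro _ ⟨i, rfl⟩ x hx
    change coneExtend p hadd hsmul x ≤ _
    rw [coneExtend_apply p hadd hsmul hx]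
    exact hple x hx i
  have h0 : p x ≤ 0 := by
    have := hP x hx
    change coneExtend p hadd hsmul x ≤ 0 at this
    rwa [coneExtend_apply p hadd hsmul hx] at this
  refine ⟨?_, fun z hz => ?_⟩
  · rintro _ ⟨i, rfl⟩
    exact hnn i x hx
  · refine le_trans (le_ciInf fun i => ?_) h0
    exact hz ⟨i, rfl⟩

theorem RieszDual.orderTendstoZero_apply {f : ι → RieszDual E} (hf : OrderTendstoZero f) {x : E}
    (hx : 0 ≤ x) : OrderTendstoZero fun i => f i x := by
  obtain ⟨y, hy, hg, hb⟩ := hf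
  exact ⟨fun i => y i x, fun i j hij => hy hij x hx, RieszDual.isGLB_apply hy hg hx,
    fun i => ⟨(hb i).1 x hx, (hb i).2 x hx⟩⟩

/-- The positive part of an order continuous functional: values along decreasing nets. -/
theorem OrderContinuousDual.isGLB_posPart {κ : Type u} [Preorder κ] [IsDirectedOrder κ]
    [Nonempty κ] {f : RieszDual E} (hf : f ∈ OrderContinuousDual E) {y : κ → E} (hy : Antitone y)
    (hg : IsGLB (Set.range y) 0) : IsGLB (Set.range fun i => f⁺ (y i)) 0 := by
  have hnn : ∀ i, 0 ≤ y i := fun i => hg.1 ⟨i, rfl⟩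
  have hfp : 0 ≤ f⁺ := posPart_nonneg f
  refine ⟨?_, fun r hr => ?_⟩
  · rintro _ ⟨i, rfl⟩
    exact RieszDual.nonneg_apply hfp (hnn i)
  obtain ⟨i₀⟩ := ‹Nonempty κ›
  have hr' : ∀ i, r ≤ f⁺ (y i) := fun i => hr ⟨i, rfl⟩
  -- every value of `f` on the order interval below `y i₀` is at most `f⁺ (y i₀) - r`
  have key : ∀ z, 0 ≤ z → z ≤ y i₀ → f z ≤ f⁺ (y i₀) - r := by
    intro z hz hzy
    have hnet : OrderTendstoZero fun i => z ⊓ y i := by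
      refine OrderTendstoZero.of_antitone (fun i j hij => inf_le_inf_left _ (hy hij)) ⟨?_, ?_⟩
      · rintro _ ⟨i, rfl⟩
        exact le_inf hz (hnn i)
      · intro w hw
        refine hg.2 ?_
        rintro _ ⟨i, rfl⟩
        exact (hw ⟨i, rfl⟩).trans inf_le_right
    obtain ⟨s, hs, hsg, hsb⟩ := hf κ _ hnet
    rw [← sub_nonpos]
    refine hsg.2 ?_
    rintro _ ⟨i, rfl⟩
    obtain ⟨k, hik, h0k⟩ := exists_ge_ge i i₀
    refine le_trans ?_ (hs hik)
    refine le_trans ?_ (hsb k).2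
    have h1 : z - z ⊓ y k ≤ y i₀ - y k := by
      rw [sub_le_iff_le_add, add_inf]
      refine le_inf ?_ ?_
      · exact le_add_of_nonneg_left (sub_nonneg.2 (hy h0k))
      · rw [sub_add_cancel]
        exact hzy
    have h2 : f (z - z ⊓ y k) ≤ f⁺ (y i₀ - y k) :=
      (RieszDual.le_def.1 (le_posPart f) _ (sub_nonneg.2 inf_le_left)).trans
        (RieszDual.mono hfp h1)
    rw [map_sub, map_sub] at h2
    have h3 := hr' k
    change f z - _ ≤ f (z ⊓ y k)
    linarith
  have h4 : f⁺ (y i₀) ≤ f⁺ (y i₀) - r := by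
    conv_lhs => rw [RieszDual.posPart_apply f (hnn i₀)]
    exact RieszDual.posVal_le f (hnn i₀) key
  linarith

theorem OrderContinuousDual.posPart_mem {f : RieszDual E} (hf : f ∈ OrderContinuousDual E) :
    f⁺ ∈ OrderContinuousDual E := by
  intro κ _ _ _ x hx
  obtain ⟨y, hy, hg, hb⟩ := hx
  have hfp : 0 ≤ f⁺ := posPart_nonneg f
  refine ⟨fun i => f⁺ (y i), fun i j hij => RieszDual.mono hfp (hy hij),
    OrderContinuousDual.isGLB_posPart hf hy hg, fun i => ⟨?_, RieszDual.mono hfp (hb i).2⟩⟩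
  rw [← map_neg]
  exact RieszDual.mono hfp (hb i).1

theorem OrderContinuousDual.negPart_mem {f : RieszDual E} (hf : f ∈ OrderContinuousDual E) :
    f⁻ ∈ OrderContinuousDual E := by
  rw [← posPart_neg]
  exact OrderContinuousDual.posPart_mem (Submodule.neg_mem _ hf)

end OrderContinuousDual

/-! ### The Arens product -/

noncomputable section Arens

variable {A : Type u} [Ring A] [Lattice A] [IsOrderedRing A] [Algebra ℝ A] [IsOrderedModule ℝ A]

theorem isOrderBounded_mulLeft (a : A) : IsOrderBounded (LinearMap.mulLeft ℝ a) :=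
  IsOrderBounded.of_sub (P := LinearMap.mulLeft ℝ a⁺) (Q := LinearMap.mulLeft ℝ a⁻)
    (fun x => by simp [← sub_mul, posPart_sub_negPart])
    (IsOrderBounded.of_nonneg fun _ hx => mul_nonneg (posPart_nonneg a) hx)
    (IsOrderBounded.of_nonneg fun _ hx => mul_nonneg (negPart_nonneg a) hx)

/-- The functional `f · a`, `(f · a)(b) = f (a b)`, as a linear function of `a`. -/
def dualAct (f : RieszDual A) : A →ₗ[ℝ] RieszDual A where
  toFun a := RieszDual.mk (f.toLin ∘ₗ LinearMap.mulLeft ℝ a)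
    (f.isOrderBounded.comp (isOrderBounded_mulLeft a))
  map_add' a b := by ext c; simp [add_mul]
  map_smul' r a := by ext c; simp

@[simp] theorem dualAct_apply (f : RieszDual A) (a b : A) : dualAct f a b = f (a * b) := rfl

theorem dualAct_nonneg {f : RieszDual A} (hf : 0 ≤ f) {a : A} (ha : 0 ≤ a) : 0 ≤ dualAct f a :=
  fun _ hb => RieszDual.nonneg_apply hf (mul_nonneg ha hb)

theorem isOrderBounded_dualAct (f : RieszDual A) : IsOrderBounded (dualAct f) :=
  IsOrderBounded.of_sub (P := dualAct f⁺) (Q := dualAct f⁻)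
    (fun a => by
      ext b
      conv_lhs => rw [dualAct_apply, f.eq_sub]
      rfl)
    (IsOrderBounded.of_nonneg fun _ ha => dualAct_nonneg (posPart_nonneg f) ha)
    (IsOrderBounded.of_nonneg fun _ ha => dualAct_nonneg (negPart_nonneg f) ha)

/-- The functional `G · f`, `(G · f)(a) = G (f · a)`, as a linear function of `f`. -/
def bidualAct (G : RieszDual (RieszDual A)) : RieszDual A →ₗ[ℝ] RieszDual A where
  toFun f := RieszDual.mk (G.toLin ∘ₗ dualAct f) (G.isOrderBounded.comp (isOrderBounded_dualAct f))
  map_add' f g := by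
    ext a
    exact map_add G (dualAct f a) (dualAct g a)
  map_smul' r f := by
    ext a
    exact map_smul G r (dualAct f a)

@[simp] theorem bidualAct_apply (G : RieszDual (RieszDual A)) (f : RieszDual A) (a : A) :
    bidualAct G f a = G (dualAct f a) := rfl

theorem bidualAct_nonneg {G : RieszDual (RieszDual A)} (hG : 0 ≤ G) {f : RieszDual A}
    (hf : 0 ≤ f) : 0 ≤ bidualAct G f :=
  fun _ ha => RieszDual.nonneg_apply hG (dualAct_nonneg hf ha)

theorem bidualAct_eq_sub (G : RieszDual (RieszDual A)) (f : RieszDual A) :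
    bidualAct G f = bidualAct G⁺ f - bidualAct G⁻ f := by
  ext a
  conv_lhs => rw [bidualAct_apply, G.eq_sub]
  rfl

theorem isOrderBounded_bidualAct (G : RieszDual (RieszDual A)) : IsOrderBounded (bidualAct G) :=
  IsOrderBounded.of_sub (bidualAct_eq_sub G)
    (IsOrderBounded.of_nonneg fun _ hf => bidualAct_nonneg (posPart_nonneg G) hf)
    (IsOrderBounded.of_nonneg fun _ hf => bidualAct_nonneg (negPart_nonneg G) hf)

theorem orderTendstoZero_bidualAct {G : RieszDual (RieszDual A)} (hG0 : 0 ≤ G)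
    (hG : G ∈ OrderContinuousDual (RieszDual A)) {κ : Type u} [Preorder κ] [IsDirectedOrder κ]
    [Nonempty κ] {f : κ → RieszDual A} (hf : OrderTendstoZero f) :
    OrderTendstoZero fun i => bidualAct G (f i) := by
  obtain ⟨y, hy, hg, hb⟩ := hf
  have hmono : ∀ {g h : RieszDual A}, g ≤ h → bidualAct G g ≤ bidualAct G h := by
    intro g h hgh
    rw [← sub_nonneg, ← map_sub]
    exact bidualAct_nonneg hG0 (sub_nonneg.2 hgh)
  have hnn : ∀ i, 0 ≤ y i := fun i => hg.1 ⟨i, rfl⟩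
  refine ⟨fun i => bidualAct G (y i), fun i j hij => hmono (hy hij), ⟨?_, ?_⟩,
    fun i => ⟨by rw [← map_neg]; exact hmono (hb i).1, hmono (hb i).2⟩⟩
  · rintro _ ⟨i, rfl⟩
    exact bidualAct_nonneg hG0 (hnn i)
  · intro h hh a ha
    have hnet : OrderTendstoZero fun i => dualAct (y i) a := by
      refine OrderTendstoZero.of_antitone
        (fun i j hij b hb => hy hij _ (mul_nonneg ha hb)) ⟨?_, ?_⟩
      · rintro _ ⟨i, rfl⟩
        exact dualAct_nonneg (hnn i) ha
      · intro k hk b hb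
        refine (RieszDual.isGLB_apply hy hg (mul_nonneg ha hb)).2 ?_
        rintro _ ⟨i, rfl⟩
        exact hk ⟨i, rfl⟩ b hb
    obtain ⟨s, hs, hsg, hsb⟩ := hG κ _ hnet
    refine hsg.2 ?_
    rintro _ ⟨i, rfl⟩
    exact (hh ⟨i, rfl⟩ a ha).trans (hsb i).2

variable (A) in
/-- The order continuous order bidual `(A^~)_n^~`, with the order induced by `A^~~`. -/
abbrev OrderBidual : Type u := ↥(OrderContinuousDual (RieszDual A))

/-- The element `F · G`, `(F · G)(f) = F (G · f)`, of `(A^~)_n^~`. -/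
def arensMul (F G : OrderBidual A) : OrderBidual A :=
  ⟨RieszDual.mk (F.1.toLin ∘ₗ bidualAct G.1)
    (F.1.isOrderBounded.comp (isOrderBounded_bidualAct G.1)), by
    intro κ _ _ _ f hf
    have hp := orderTendstoZero_bidualAct (posPart_nonneg G.1)
      (OrderContinuousDual.posPart_mem G.2) hf
    have hn := orderTendstoZero_bidualAct (negPart_nonneg G.1)
      (OrderContinuousDual.negPart_mem G.2) hf
    have h := hp.add hn.neg
    have h' := F.2 κ _ h
    refine cast (congrArg OrderTendstoZero (funext fun i => ?_)) h'
    change F.1 _ = F.1 _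
    rw [bidualAct_eq_sub G.1, sub_eq_add_neg]⟩

/-- The canonical map of `A` into `(A^~)_n^~`: evaluation at an element of `A`. -/
def bidualEval (a : A) : OrderBidual A :=
  ⟨RieszDual.mk
    { toFun := fun f => f a
      map_add' := fun _ _ => rfl
      map_smul' := fun _ _ => rfl }
    (IsOrderBounded.of_sub
      (P := { toFun := fun f => f a⁺, map_add' := fun _ _ => rfl, map_smul' := fun _ _ => rfl })
      (Q := { toFun := fun f => f a⁻, map_add' := fun _ _ => rfl, map_smul' := fun _ _ => rfl })
      (fun f => by
        change f a = f a⁺ - f a⁻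
        rw [← map_sub, posPart_sub_negPart])
      (IsOrderBounded.of_nonneg fun f hf => hf _ (posPart_nonneg a))
      (IsOrderBounded.of_nonneg fun f hf => hf _ (negPart_nonneg a))), by
    intro κ _ _ _ f hf
    have h := (RieszDual.orderTendstoZero_apply hf (posPart_nonneg a)).add
      (RieszDual.orderTendstoZero_apply hf (negPart_nonneg a)).neg
    refine cast (congrArg OrderTendstoZero (funext fun i => ?_)) h
    change f i a⁺ + -f i a⁻ = f i a
    rw [← sub_eq_add_neg, ← map_sub, posPart_sub_negPart]⟩

instance : Mul (OrderBidual A) := ⟨arensMul⟩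
instance : One (OrderBidual A) := ⟨bidualEval 1⟩

theorem OrderBidual.mul_apply (F G : OrderBidual A) (f : RieszDual A) :
    (F * G).1 f = F.1 (bidualAct G.1 f) := rfl

@[simp] theorem bidualEval_apply (a : A) (f : RieszDual A) : (bidualEval a).1 f = f a := rfl

theorem OrderBidual.one_apply (f : RieszDual A) : (1 : OrderBidual A).1 f = f 1 := rfl

theorem OrderBidual.ext' {F G : OrderBidual A} (h : ∀ f, F.1 f = G.1 f) : F = G :=
  Subtype.ext (RieszDual.ext h)

/-- `(A^~)_n^~` is a unital associative algebra under the Arens product. -/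
instance : Ring (OrderBidual A) where
  mul_assoc _ _ _ := OrderBidual.ext' fun f => by
    simp only [OrderBidual.mul_apply]
    congr 1
    ext a
    simp only [bidualAct_apply, OrderBidual.mul_apply]
    congr 1
    ext b
    simp only [bidualAct_apply, dualAct_apply]
    congr 1
    ext c
    simp [mul_assoc]
  left_distrib F G H := OrderBidual.ext' fun f => by
    simp only [OrderBidual.mul_apply]
    exact map_add F.1 (bidualAct G.1 f) (bidualAct H.1 f)
  right_distrib F G H := OrderBidual.ext' fun f => rfl
  zero_mul F := OrderBidual.ext' fun f => rfl
  mul_zero F := OrderBidual.ext' fun f => map_zero F.1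
  one_mul F := OrderBidual.ext' fun f => by
    simp only [OrderBidual.mul_apply, OrderBidual.one_apply, bidualAct_apply]
    congr 1
    ext a
    simp
  mul_one F := OrderBidual.ext' fun f => by
    simp only [OrderBidual.mul_apply]
    congr 1
    ext a
    simp [OrderBidual.one_apply]
  neg_add_cancel F := neg_add_cancel F
  zsmul := fun n F => n • F
  zsmul_zero' := SubNegMonoid.zsmul_zero'
  zsmul_succ' := SubNegMonoid.zsmul_succ'
  zsmul_neg' := SubNegMonoid.zsmul_neg'
  nsmul := fun n F => n • F
  nsmul_zero := AddMonoid.nsmul_zero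
  nsmul_succ := AddMonoid.nsmul_succ
  sub_eq_add_neg := SubNegMonoid.sub_eq_add_neg

instance : Algebra ℝ (OrderBidual A) :=
  Algebra.ofModule
    (fun _ _ _ => OrderBidual.ext' fun _ => rfl)
    (fun r F G => OrderBidual.ext' fun f => map_smul F.1 r (bidualAct G.1 f))

end Arens

/-! ### The Arens homomorphism -/

noncomputable section ArensHom

variable {E : Type u} [AddCommGroup E] [Lattice E] [IsOrderedAddMonoid E] [Module ℝ E]
  [IsOrderedModule ℝ E]

/-- The adjoint `π' : E^~ → E^~`, `π' f = f ∘ π`, of an orthomorphism `π`. -/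
def Orth.adjoint (π : ↥(Orth E)) : RieszDual E →ₗ[ℝ] RieszDual E where
  toFun f := RieszDual.mk (f.toLin ∘ₗ π.1) (f.isOrderBounded.comp π.2.1)
  map_add' _ _ := rfl
  map_smul' _ _ := rfl

@[simp] theorem Orth.adjoint_apply (π : ↥(Orth E)) (f : RieszDual E) (x : E) :
    Orth.adjoint π f x = f (π.1 x) := rfl

variable [HasSeparatingOrderDual E]

/-- Evaluation of orthomorphisms at `x`. -/
def orthEval (x : E) : ↥(Orth E) →ₗ[ℝ] E where
  toFun π := π.1 x
  map_add' _ _ := rfl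
  map_smul' _ _ := rfl

theorem isOrderBounded_orthEval (x : E) : IsOrderBounded (orthEval x) :=
  IsOrderBounded.of_sub (P := orthEval x⁺) (Q := orthEval x⁻)
    (fun π => by
      change π.1 x = π.1 x⁺ - π.1 x⁻
      rw [← map_sub, posPart_sub_negPart])
    (IsOrderBounded.of_nonneg fun π hπ => hπ _ (posPart_nonneg x))
    (IsOrderBounded.of_nonneg fun π hπ => hπ _ (negPart_nonneg x))

/-- The functional `ψ_{x,f}` in `Orth(E)^~`, `ψ_{x,f}(π) = f (π x)`, as a linear function
of `x`. -/
def psi (f : RieszDual E) : E →ₗ[ℝ] RieszDual ↥(Orth E) where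
  toFun x := RieszDual.mk (f.toLin ∘ₗ orthEval x)
    (f.isOrderBounded.comp (isOrderBounded_orthEval x))
  map_add' x y := by
    ext π
    change f (π.1 (x + y)) = f (π.1 x) + f (π.1 y)
    rw [map_add, map_add]
  map_smul' r x := by
    ext π
    change f (π.1 (r • x)) = r * f (π.1 x)
    rw [map_smul, map_smul, smul_eq_mul]

@[simp] theorem psi_apply (f : RieszDual E) (x : E) (π : ↥(Orth E)) : psi f x π = f (π.1 x) := rfl

theorem psi_nonneg {f : RieszDual E} (hf : 0 ≤ f) {x : E} (hx : 0 ≤ x) : 0 ≤ psi f x :=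
  fun π hπ => RieszDual.nonneg_apply hf (hπ x hx)

theorem isOrderBounded_psi (f : RieszDual E) : IsOrderBounded (psi f) :=
  IsOrderBounded.of_sub (P := psi f⁺) (Q := psi f⁻)
    (fun x => by
      ext π
      conv_lhs => rw [psi_apply, f.eq_sub]
      rfl)
    (IsOrderBounded.of_nonneg fun _ hx => psi_nonneg (posPart_nonneg f) hx)
    (IsOrderBounded.of_nonneg fun _ hx => psi_nonneg (negPart_nonneg f) hx)

/-- The functional `F • f` in `E^~`, `(F • f)(x) = F (ψ_{x,f})`, as a linear function of `f`. -/
def bullet (F : RieszDual (RieszDual ↥(Orth E))) : RieszDual E →ₗ[ℝ] RieszDual E where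
  toFun f := RieszDual.mk (F.toLin ∘ₗ psi f) (F.isOrderBounded.comp (isOrderBounded_psi f))
  map_add' f g := by
    ext x
    exact map_add F (psi f x) (psi g x)
  map_smul' r f := by
    ext x
    exact map_smul F r (psi f x)

@[simp] theorem bullet_apply (F : RieszDual (RieszDual ↥(Orth E))) (f : RieszDual E) (x : E) :
    bullet F f x = F (psi f x) := rfl

theorem bullet_nonneg {F : RieszDual (RieszDual ↥(Orth E))} (hF : 0 ≤ F) {f : RieszDual E}
    (hf : 0 ≤ f) : 0 ≤ bullet F f :=
  fun _ hx => RieszDual.nonneg_apply hF (psi_nonneg hf hx)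

theorem isOrderBounded_bullet (F : RieszDual (RieszDual ↥(Orth E))) : IsOrderBounded (bullet F) :=
  IsOrderBounded.of_sub (P := bullet F⁺) (Q := bullet F⁻)
    (fun f => by
      ext x
      conv_lhs => rw [bullet_apply, F.eq_sub]
      rfl)
    (IsOrderBounded.of_nonneg fun _ hf => bullet_nonneg (posPart_nonneg F) hf)
    (IsOrderBounded.of_nonneg fun _ hf => bullet_nonneg (negPart_nonneg F) hf)

variable (E) in
/-- The Arens homomorphism `γ : (Orth(E)^~)_n^~ → L_b(E^~)`, `γ(F)(f) = F • f`. -/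
def arensHom : OrderBidual ↥(Orth E) →ₗ[ℝ] ↥(Lb (RieszDual E)) where
  toFun F := ⟨bullet F.1, isOrderBounded_bullet F.1⟩
  map_add' _ _ := rfl
  map_smul' _ _ := rfl

@[simp] theorem arensHom_apply (F : OrderBidual ↥(Orth E)) (f : RieszDual E) (x : E) :
    (arensHom E F).1 f x = F.1 (psi f x) := rfl

end ArensHom

end RieszSpace

open RieszSpace

/-! Write `F • f` for `γ(F)(f)`. Linearity, positivity and the value of `γ` at `π̂` come directly
from the definition. The other claims rest on three facts.

First, since `E^~` separates points, `E` is Archimedean, and `A = Orth(E)` is an Archimedean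
f-algebra with unit: multiplication by positive elements preserves disjointness. Such an algebra is
commutative (`IsArchimedeanFAlgebra.mul_comm`). Unwinding the Arens product, multiplicativity of `γ`
says exactly that `f(πσx) = f(σπx)` may be used under `F` and `G`.

Second, a positive functional on `A` that vanishes at the unit is zero, because `n (a - n)⁺ ≤ a²`. A
Borel–Cantelli argument turns this into absolute continuity (`exists_apply_lt_of_apply_one_lt`): for
order continuous `F ≥ 0`, on an interval `[0, φ]` of `A^~`, the number `F μ` is small as soon as `μ
1` is small. If `f ⊓ g = 0` and `x ≥ 0`, the Riesz–Kantorovich formula gives `0 ≤ y ≤ x` with `f y`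
and `g (x - y)` small. As `ψ_{y,f}(1) = f y`, also `(F • f)(y)` is small, so `(F • f) ⊓ g` vanishes
at `x`. Thus `γ(F)` preserves disjointness. Bands of the Archimedean space `E^~` are their own
double disjoint complements, so `γ(F)` lies in `Orth(E^~)`.

Third, by Hahn–Banach, `[0, ψ_{x,f}]` consists of functionals `ψ_{x,g}` with `0 ≤ g ≤ f`
(`exists_psi_eq`). So the Riesz–Kantorovich formula for `F ⊓ G` at `ψ_{x,f}` involves only values
`(F • g)(x) + (G • (f - g))(x)`. Infima in `Orth(E^~)` are pointwise on the positive cone, hence `(F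
• f) ⊓ (G • f)` is additive in `f ≥ 0` and is bounded by these sums. Therefore `F ⊓ G = 0` forces
`(F • f) ⊓ (G • f) = 0`, which gives the Riesz homomorphism property.

Order continuity follows because infima of decreasing nets in a dual are pointwise, once an infimum
in `(A^~)_n^~` is seen to be an infimum in `A^~~`. -/

namespace RieszSpace

/-! ### Disjointness in lattice ordered groups. -/

section LatticeOrderedGroup

variable {E : Type u} [AddCommGroup E] [Lattice E] [IsOrderedAddMonoid E]

theorem inf_eq_zero_of_le {a b c : E} (ha : 0 ≤ a) (hc : 0 ≤ c) (hab : a ≤ b) (h : b ⊓ c = 0) :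
    a ⊓ c = 0 :=
  le_antisymm ((inf_le_inf_right c hab).trans h.le) (le_inf ha hc)

theorem add_inf_eq_zero [Module ℝ E] [IsOrderedModule ℝ E] {a b c : E} (ha : 0 ≤ a) (hb : 0 ≤ b)
    (hc : 0 ≤ c) (hac : a ⊓ c = 0) (hbc : b ⊓ c = 0) : (a + b) ⊓ c = 0 := by
  refine le_antisymm ((add_inf_le_inf_add_inf ha hb hc).trans ?_) (le_inf (add_nonneg ha hb) hc)
  rw [hac, hbc, add_zero]

theorem posPart_le_abs (x : E) : x⁺ ≤ |x| := by
  rw [← posPart_add_negPart]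
  exact le_add_of_nonneg_right (negPart_nonneg x)

/-- Since `|x| = x + 2x⁻`, passing from `x` to `|x|` costs two copies of `x⁻`. This drives the
induction in `abs_smul_commutator_le`. -/
theorem negPart_sub_le (x e : E) : (x - e)⁻ ≤ (|x| - e)⁻ + (x⁻ + x⁻) := by
  rw [negPart_def (x - e)]
  refine sup_le ?_ (add_nonneg (negPart_nonneg _) (add_nonneg (negPart_nonneg _)
    (negPart_nonneg _)))
  have h : -(x - e) = -(|x| - e) + (x⁻ + x⁻) := by
    rw [← posPart_add_negPart x]
    conv_lhs => rw [← posPart_sub_negPart x]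
    abel
  rw [h]
  exact add_le_add_left (neg_le_negPart _) _

end LatticeOrderedGroup

/-! ### Archimedean f-algebras with unit. -/

/-- An Archimedean lattice ordered algebra in which multiplication by positive elements preserves
disjointness. -/
class IsArchimedeanFAlgebra (A : Type u) [Ring A] [Lattice A] [IsOrderedRing A] [Algebra ℝ A]
    [IsOrderedModule ℝ A] : Prop where
  archimedean : ∀ x y : A, 0 ≤ x → (∀ n : ℕ, (n : ℝ) • x ≤ y) → x = 0
  mul_left_inf : ∀ a b c : A, 0 ≤ c → a ⊓ b = 0 → (c * a) ⊓ b = 0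
  mul_right_inf : ∀ a b c : A, 0 ≤ c → a ⊓ b = 0 → (a * c) ⊓ b = 0

namespace IsArchimedeanFAlgebra

variable {A : Type u} [Ring A] [Lattice A] [IsOrderedRing A] [Algebra ℝ A] [IsOrderedModule ℝ A]
  [IsArchimedeanFAlgebra A]

theorem eq_zero_of_inf_one {z : A} (hz : 0 ≤ z) (h : z ⊓ 1 = 0) : z = 0 := by
  have := mul_left_inf 1 z z hz (by rwa [inf_comm])
  rwa [mul_one, inf_idem] at this

/-- Multiplying one factor at a time, `a * b` is disjoint from `b`, and then from `a * b` itself. -/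
theorem mul_eq_zero_of_inf {a b : A} (h : a ⊓ b = 0) : a * b = 0 := by
  have ha : 0 ≤ a := h ▸ inf_le_left
  have hb : 0 ≤ b := h ▸ inf_le_right
  have h1 := mul_right_inf a b b hb h
  have h2 := mul_left_inf b (a * b) a ha (by rwa [inf_comm])
  rwa [inf_idem] at h2

theorem abs_mul_le (a : A) {b : A} (hb : 0 ≤ b) : |a * b| ≤ |a| * b := by
  refine abs_le'.2 ⟨mul_le_mul_of_nonneg_right (le_abs_self a) hb, ?_⟩
  rw [← neg_mul]
  exact mul_le_mul_of_nonneg_right (neg_le_abs a) hb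

theorem abs_mul_le' {a : A} (ha : 0 ≤ a) (b : A) : |a * b| ≤ a * |b| := by
  refine abs_le'.2 ⟨mul_le_mul_of_nonneg_left (le_abs_self b) ha, ?_⟩
  rw [← mul_neg]
  exact mul_le_mul_of_nonneg_left (neg_le_abs b) ha

/-- An element `z ≥ 0` that is disjoint from all `(c - k)⁻` vanishes. -/
theorem eq_zero_of_inf_negPart {z c : A} (hz : 0 ≤ z) (hc : 0 ≤ c)
    (h : ∀ k : ℕ, z ⊓ (c - (k : ℝ) • (1 : A))⁻ = 0) : z = 0 := by
  refine eq_zero_of_inf_one hz ?_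
  -- It suffices that `k (z ⊓ 1) ≤ c` for all `k`. Now `k (z ⊓ 1) ≤ k ≤ (c - k)⁻ + c`, and the left
  -- side is disjoint from `(c - k)⁻`, so only `c` contributes.
  have hv : 0 ≤ z ⊓ 1 := le_inf hz zero_le_one
  refine archimedean (z ⊓ 1) c hv fun k => ?_
  have hkv : 0 ≤ (k : ℝ) • (z ⊓ 1) := smul_nonneg k.cast_nonneg hv
  have h1 : (z ⊓ 1) ⊓ (c - (k : ℝ) • (1 : A))⁻ = 0 :=
    inf_eq_zero_of_le hv (negPart_nonneg _) inf_le_left (h k)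
  have h2 := abs_smul_inf_eq_zero (by rwa [abs_of_nonneg hv]) (negPart_nonneg _) (k : ℝ)
  rw [abs_of_nonneg hkv] at h2
  have h3 : (k : ℝ) • (z ⊓ 1) ≤ (c - (k : ℝ) • (1 : A))⁻ + c := by
    refine (smul_le_smul_of_nonneg_left inf_le_right k.cast_nonneg).trans ?_
    rw [← sub_le_iff_le_add, ← neg_sub]
    exact neg_le_negPart _
  calc (k : ℝ) • (z ⊓ 1) = ((c - (k : ℝ) • (1 : A))⁻ + c) ⊓ ((k : ℝ) • (z ⊓ 1)) :=
        (inf_eq_right.2 h3).symm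
    _ ≤ (c - (k : ℝ) • (1 : A))⁻ ⊓ ((k : ℝ) • (z ⊓ 1)) + c ⊓ ((k : ℝ) • (z ⊓ 1)) :=
        add_inf_le_inf_add_inf (negPart_nonneg _) hc hkv
    _ ≤ c := by rw [inf_comm, h2, zero_add]; exact inf_le_left

/-- Replacing `n a` by `r = n a - k` does not change the commutator with `b`. Where `|r| ≤ 1`, it is
bounded by `|r| b + b |r| ≤ b + b`, and the regions `|n a - k| < 1` for natural `k` cover
everything. Disjointness expresses these regions: the excess `z` is disjoint from every `(|n a - k|
- 1)⁻`, hence zero. -/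
theorem abs_smul_commutator_le {a b : A} (ha : 0 ≤ a) (hb : 0 ≤ b) (n : ℕ) :
    |(n : ℝ) • (a * b - b * a)| ≤ b + b := by
  set z : A := (|(n : ℝ) • (a * b - b * a)| - (b + b))⁺ with hz
  have hz0 : 0 ≤ z := posPart_nonneg _
  have hat : ∀ r : A, (n : ℝ) • (a * b - b * a) = r * b - b * r → z ⊓ (|r| - 1)⁻ = 0 := by
    intro r hr
    set q := (|r| - 1)⁺ with hq
    have hq0 : 0 ≤ q := posPart_nonneg _
    have hqW : q ⊓ (|r| - 1)⁻ = 0 := posPart_inf_negPart_eq_zero _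
    have hle : z ≤ q * b + b * q := by
      rw [hz, posPart_def]
      refine sup_le ?_ (add_nonneg (mul_nonneg hq0 hb) (mul_nonneg hb hq0))
      have h1 : |(n : ℝ) • (a * b - b * a)| ≤ |r| * b + b * |r| := by
        rw [hr, sub_eq_add_neg]
        refine (abs_add_le _ _).trans ?_
        rw [abs_neg]
        exact add_le_add (abs_mul_le r hb) (abs_mul_le' hb r)
      have h2 : |r| * b + b * |r| - (b + b) = (|r| - 1) * b + b * (|r| - 1) := by
        rw [sub_mul, mul_sub, one_mul, mul_one]
        abel
      refine (sub_le_sub_right h1 _).trans ?_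
      rw [h2]
      exact add_le_add (mul_le_mul_of_nonneg_right (le_posPart _) hb)
        (mul_le_mul_of_nonneg_left (le_posPart _) hb)
    refine inf_eq_zero_of_le hz0 (negPart_nonneg _) hle ?_
    exact add_inf_eq_zero (mul_nonneg hq0 hb) (mul_nonneg hb hq0) (negPart_nonneg _)
      (mul_right_inf _ _ _ hb hqW) (mul_left_inf _ _ _ hb hqW)
  have hz1 : z = 0 := by
    refine eq_zero_of_inf_negPart (c := (n : ℝ) • a) hz0 (smul_nonneg n.cast_nonneg ha) fun k => ?_
    -- The set where `n a < k + 1` is covered by those where `n a < k` and where `|n a - k| < 1`;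
    -- `negPart_sub_le` is this covering in terms of negative parts.
    induction k with
    | zero =>
      rw [Nat.cast_zero, zero_smul, sub_zero,
        negPart_of_nonneg (smul_nonneg (n.cast_nonneg (α := ℝ)) ha)]
      exact inf_eq_right.2 hz0
    | succ k ih =>
      set r : A := (n : ℝ) • a - (k : ℝ) • (1 : A) with hr
      have h1 : (n : ℝ) • a - ((k + 1 : ℕ) : ℝ) • (1 : A) = r - 1 := by
        rw [hr, Nat.cast_succ, add_smul, one_smul, sub_sub]
      have h2 := hat r (by
        rw [hr, sub_mul, mul_sub]
        simp [smul_sub])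
      rw [h1, inf_comm]
      rw [inf_comm] at ih h2
      refine inf_eq_zero_of_le (negPart_nonneg _) hz0 (negPart_sub_le r 1) ?_
      exact add_inf_eq_zero (negPart_nonneg _) (add_nonneg (negPart_nonneg _) (negPart_nonneg _))
        hz0 h2 (add_inf_eq_zero (negPart_nonneg _) (negPart_nonneg _) hz0 ih ih)
  exact sub_nonpos.1 ((le_posPart _).trans hz1.le)

/-- The bound `b + b` on `n` times the commutator does not depend on `n`, so the Archimedean
property applies. -/
theorem mul_comm_of_nonneg {a b : A} (ha : 0 ≤ a) (hb : 0 ≤ b) : a * b = b * a := by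
  have key : ∀ x : A, (∀ n : ℕ, |(n : ℝ) • x| ≤ b + b) → x ≤ 0 := by
    intro x hx
    refine (le_posPart x).trans (le_of_eq ?_)
    refine archimedean _ (b + b) (posPart_nonneg x) fun n => ?_
    rw [← posPart_smul_of_nonneg n.cast_nonneg]
    exact (posPart_le_abs _).trans (hx n)
  refine le_antisymm (sub_nonpos.1 (key _ (abs_smul_commutator_le ha hb)))
    (sub_nonpos.1 (key _ fun n => ?_))
  rw [← neg_sub, smul_neg, abs_neg]
  exact abs_smul_commutator_le ha hb n

/-- An Archimedean f-algebra is commutative. -/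
protected theorem mul_comm (a b : A) : a * b = b * a := by
  rw [← posPart_sub_negPart a, ← posPart_sub_negPart b]
  simp only [sub_mul, mul_sub]
  rw [mul_comm_of_nonneg (posPart_nonneg a) (posPart_nonneg b),
    mul_comm_of_nonneg (posPart_nonneg a) (negPart_nonneg b),
    mul_comm_of_nonneg (negPart_nonneg a) (posPart_nonneg b),
    mul_comm_of_nonneg (negPart_nonneg a) (negPart_nonneg b)]
  abel

/-- With `p = (a - n)⁺`, the product `(a - n) p = p²` is positive, so `n p ≤ a p ≤ a²`. -/
theorem smul_posPart_sub_le {a : A} (ha : 0 ≤ a) (n : ℕ) :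
    (n : ℝ) • (a - (n : ℝ) • (1 : A))⁺ ≤ a * a := by
  set p := (a - (n : ℝ) • (1 : A))⁺ with hp
  have hp0 : 0 ≤ p := posPart_nonneg _
  have h1 : (a - (n : ℝ) • (1 : A)) * p = p * p := by
    conv_lhs => rw [← posPart_sub_negPart (a - (n : ℝ) • (1 : A)), sub_mul]
    rw [mul_eq_zero_of_inf (a := (a - (n : ℝ) • (1 : A))⁻)
      (by rw [inf_comm]; exact posPart_inf_negPart_eq_zero _), sub_zero]
  have h2 : 0 ≤ a * p - (n : ℝ) • p := by
    rw [sub_mul, smul_mul_assoc, one_mul] at h1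
    rw [h1]
    exact mul_nonneg hp0 hp0
  have h3 : p ≤ a := by
    rw [hp, posPart_def]
    exact sup_le (sub_le_self _ (smul_nonneg n.cast_nonneg zero_le_one)) ha
  exact (sub_nonneg.1 h2).trans (mul_le_mul_of_nonneg_left h3 ha)

/-- A positive functional on an Archimedean f-algebra that vanishes at the unit is zero. -/
theorem eq_zero_of_apply_one {f : RieszDual A} (hf : 0 ≤ f) (h1 : f 1 ≤ 0) : f = 0 := by
  refine RieszDual.ext_nonneg fun a ha => ?_
  have h0 := RieszDual.nonneg_apply hf ha
  -- Because `f 1 ≤ 0`, cutting `a` down to `(a - n)⁺` does not decrease the value of `f`.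
  have key : ∀ n : ℕ, (n : ℝ) * f a ≤ f (a * a) := by
    intro n
    have h2 : f a ≤ f (a - (n : ℝ) • (1 : A))⁺ := by
      have h3 := RieszDual.mono hf (le_posPart (a - (n : ℝ) • (1 : A)))
      rw [map_sub, map_smul, smul_eq_mul] at h3
      have h4 : (n : ℝ) * f 1 ≤ 0 := mul_nonpos_of_nonneg_of_nonpos n.cast_nonneg h1
      linarith
    have h5 := RieszDual.mono hf (smul_posPart_sub_le ha n)
    rw [map_smul, smul_eq_mul] at h5
    exact (mul_le_mul_of_nonneg_left h2 n.cast_nonneg).trans h5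
  refine le_antisymm ?_ h0
  by_contra hpos
  push Not at hpos
  obtain ⟨n, hn⟩ := exists_nat_gt (f (a * a) / f a)
  rw [div_lt_iff₀ hpos] at hn
  exact absurd (key n) (not_le.2 hn)

end IsArchimedeanFAlgebra

/-! ### `Orth(E)` as an Archimedean f-algebra. -/

namespace Orth

variable {E : Type u} [AddCommGroup E] [Lattice E] [IsOrderedAddMonoid E] [Module ℝ E]
  [IsOrderedModule ℝ E] [HasSeparatingOrderDual E]

theorem posPart_apply (T : ↥(Orth E)) {x : E} (hx : 0 ≤ x) : (T⁺).1 x = (T.1 x)⁺ := by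
  change (pos (T - 0) + 0).1 x = _
  rw [sub_zero, add_zero]
  exact pos_apply T hx

/-- The infimum of two orthomorphisms is computed pointwise on the positive cone. -/
theorem inf_apply (S T : ↥(Orth E)) {x : E} (hx : 0 ≤ x) : (S ⊓ T).1 x = S.1 x ⊓ T.1 x := by
  rw [inf_eq_sub_posPart_sub S T, inf_eq_sub_posPart_sub]
  change S.1 x - ((S - T)⁺).1 x = _
  rw [posPart_apply _ hx]
  rfl

instance : IsArchimedeanFAlgebra ↥(Orth E) where
  archimedean S T hS h := Subtype.ext <| linearMap_ext_nonneg fun x hx =>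
    eq_zero_of_nsmul_le (hS x hx) fun n => h n x hx
  mul_left_inf S T R hR h := Subtype.ext <| linearMap_ext_nonneg fun x hx => by
    have hS : 0 ≤ S := h ▸ inf_le_left
    have hT : 0 ≤ T := h ▸ inf_le_right
    have h1 : S.1 x ⊓ T.1 x = 0 := by rw [← inf_apply S T hx, h]; rfl
    rw [inf_apply _ _ hx]
    have h2 := disjoint_apply R (hT x hx) (x := S.1 x) (by rwa [abs_of_nonneg (hS x hx)])
    rwa [abs_of_nonneg (hR _ (hS x hx))] at h2
  mul_right_inf S T R hR h := Subtype.ext <| linearMap_ext_nonneg fun x hx => by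
    have hS : 0 ≤ S := h ▸ inf_le_left
    have hT : 0 ≤ T := h ▸ inf_le_right
    have hRx := hR x hx
    -- A common majorant of `R x` and `x`: there the values of `S` and `T` are disjoint, and they
    -- dominate `S (R x)` and `T x`.
    have hy : 0 ≤ R.1 x + x := add_nonneg hRx hx
    have h1 : S.1 (R.1 x + x) ⊓ T.1 (R.1 x + x) = 0 := by rw [← inf_apply S T hy, h]; rfl
    rw [inf_apply _ _ hx]
    refine le_antisymm (le_trans (inf_le_inf ?_ ?_) h1.le) (le_inf (hS _ hRx) (hT _ hx))
    · exact mono hS (le_add_of_nonneg_right hx)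
    · exact mono hT (le_add_of_nonneg_left hRx)

end Orth

end RieszSpace

namespace RieszSpace

/-! ### Bands in Archimedean Riesz spaces. -/

section Bands

variable {E : Type u} [AddCommGroup E] [Lattice E] [IsOrderedAddMonoid E] [Module ℝ E]
  [IsOrderedModule ℝ E] [HasSeparatingOrderDual E]

/-- In an Archimedean Riesz space, a band contains its double disjoint complement. -/
theorem IsBand.mem_of_disjoint {B : Submodule ℝ E} (hB : IsBand B) {u : E}
    (h : ∀ z, 0 ≤ z → (∀ b ∈ B, |b| ⊓ z = 0) → |u| ⊓ z = 0) : u ∈ B := by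
  have hp : |u| ∈ B := by
    refine hB.sup_mem {v | v ∈ B ∧ 0 ≤ v ∧ v ≤ |u|} (fun v hv => hv.1)
      ⟨0, B.zero_mem, le_rfl, abs_nonneg u⟩ |u| ⟨fun v hv => hv.2.2, fun w hw => ?_⟩
    -- The part of `|u|` that the upper bound `w` misses. It is disjoint from `B`, hence from `u`;
    -- being at most `|u|`, it is zero.
    set z : E := |u| - w ⊓ |u| with hz
    have hz0 : 0 ≤ z := sub_nonneg.2 inf_le_right
    have hw0 : 0 ≤ w ⊓ |u| := le_inf (hw ⟨B.zero_mem, le_rfl, abs_nonneg u⟩) (abs_nonneg u)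
    have hdisj : |u| ⊓ z = 0 := by
      refine h z hz0 fun b hb => ?_
      have hc0 : 0 ≤ |b| ⊓ z := le_inf (abs_nonneg b) hz0
      have hcB : |b| ⊓ z ∈ B := hB.solid hb (by rw [abs_of_nonneg hc0]; exact inf_le_left)
      refine eq_zero_of_nsmul_le (y := |u|) hc0 fun n => ?_
      induction n with
      | zero => simp
      | succ n ih =>
        -- The multiple already lies in `B` and below `|u|`, so `w` bounds it. One more copy fits
        -- under `z`, and `w ⊓ |u| + z = |u|`.
        have h1 : (n : ℝ) • (|b| ⊓ z) ≤ w ⊓ |u| :=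
          le_inf (hw ⟨B.smul_mem _ hcB, smul_nonneg n.cast_nonneg hc0, ih⟩) ih
        rw [Nat.cast_succ, add_smul, one_smul]
        refine (add_le_add h1 inf_le_right).trans (le_of_eq ?_)
        rw [hz, add_sub_cancel]
    have hz1 : z = 0 := by
      rw [← hdisj]
      exact (inf_eq_right.2 (sub_le_self _ hw0)).symm
    rw [sub_eq_zero.1 hz1]
    exact inf_le_left
  exact hB.solid hp (abs_abs u).ge

end Bands

/-! ### Infima, monotone limits and order continuity in the order dual. -/

namespace RieszDual

open Filter Topology

variable {E : Type u} [AddCommGroup E] [Lattice E] [IsOrderedAddMonoid E] [Module ℝ E]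
  [IsOrderedModule ℝ E]

/-- Evaluations at positive elements are positive functionals on `E^~` and separate its points. So
`E^~` is Archimedean, and the results on bands and on the lattice `Orth` apply to it. -/
instance : HasSeparatingOrderDual (RieszDual E) where
  separates f hf := by
    have : ∃ x, 0 ≤ x ∧ f x ≠ 0 := by
      by_contra! h
      exact hf (ext_nonneg h)
    obtain ⟨x, hx, hfx⟩ := this
    exact ⟨mk { toFun := fun g => g x, map_add' := fun _ _ => rfl, map_smul' := fun _ _ => rfl }
      (IsOrderBounded.of_nonneg fun g hg => hg x hx), hfx⟩

theorem inf_apply_le (f g : RieszDual E) {x y : E} (hy : 0 ≤ y) (hyx : y ≤ x) :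
    (f ⊓ g) x ≤ f y + g (x - y) := by
  have h1 := le_def.1 (inf_le_left : f ⊓ g ≤ f) y hy
  have h2 := le_def.1 (inf_le_right : f ⊓ g ≤ g) (x - y) (sub_nonneg.2 hyx)
  have h3 : (f ⊓ g) x = (f ⊓ g) y + (f ⊓ g) (x - y) := by rw [← map_add, add_sub_cancel]
  linarith

/-- The Riesz–Kantorovich formula for the infimum of two functionals. -/
theorem exists_add_lt_inf_apply (f g : RieszDual E) {x : E} (hx : 0 ≤ x) {ε : ℝ} (hε : 0 < ε) :
    ∃ y, 0 ≤ y ∧ y ≤ x ∧ f y + g (x - y) < (f ⊓ g) x + ε := by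
  have h1 : (f ⊓ g) x = f x - sSup ((f - g) '' Set.Icc 0 x) := by
    rw [← posPart_apply _ hx, inf_eq_sub_posPart_sub]
    rfl
  obtain ⟨_, ⟨y, hy, rfl⟩, h2⟩ := exists_lt_of_lt_csSup
    (⟨_, 0, ⟨le_rfl, hx⟩, rfl⟩ : ((f - g) '' Set.Icc 0 x).Nonempty)
    (sub_lt_self (sSup ((f - g) '' Set.Icc 0 x)) hε)
  -- As `f ⊓ g = f - (f - g)⁺`, an almost maximal `y` for `f - g` is the portion to be given to `g`;
  -- `f` gets the rest.
  refine ⟨x - y, sub_nonneg.2 hy.2, sub_le_self _ hy.1, ?_⟩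
  rw [sub_sub_cancel, map_sub, h1]
  rw [sub_apply] at h2
  linarith

/-- A bounded increasing sequence of functionals has a pointwise supremum. -/
theorem exists_tendsto_of_monotone {u : ℕ → RieszDual E} (hu : Monotone u) {φ : RieszDual E}
    (hφ : ∀ n, u n ≤ φ) : ∃ U : RieszDual E, ∀ x, Tendsto (fun n => u n x) atTop (𝓝 (U x)) := by
  have hpos : ∀ x, 0 ≤ x → Tendsto (fun n => u n x) atTop (𝓝 (⨆ n, u n x)) := fun x hx =>
    tendsto_atTop_ciSup (fun i j hij => hu hij x hx)
      ⟨φ x, by rintro _ ⟨n, rfl⟩; exact hφ n x hx⟩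
  have hlim : ∀ x, ∃ r, Tendsto (fun n => u n x) atTop (𝓝 r) := fun x => by
    refine ⟨_, Tendsto.congr (fun n => ?_) ((hpos _ (posPart_nonneg x)).sub
      (hpos _ (negPart_nonneg x)))⟩
    rw [← map_sub, posPart_sub_negPart]
  choose p hp using hlim
  let V : E →ₗ[ℝ] ℝ := linearMapOfTendsto p (fun n => (u n).toLin) (tendsto_pi_nhds.2 hp)
  have hV : ∀ x, V x = p x := fun x => rfl
  -- The limit is the sum of a positive functional and `u 0`, hence order bounded.
  have hVu : ∀ x, 0 ≤ x → 0 ≤ (V - (u 0).toLin) x := fun x hx => by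
    rw [LinearMap.sub_apply, hV, toLin_apply, sub_nonneg]
    exact ge_of_tendsto' (hp x) fun n => hu (Nat.zero_le n) x hx
  refine ⟨mk V ?_, hp⟩
  have := (IsOrderBounded.of_nonneg hVu).add (u 0).isOrderBounded
  rwa [sub_add_cancel] at this

/-- A positive functional that is dominated by an order continuous one is order continuous. -/
theorem mem_orderContinuousDual_of_le {f g : RieszDual E} (hf : 0 ≤ f) (hfg : f ≤ g)
    (hg : g ∈ OrderContinuousDual E) : f ∈ OrderContinuousDual E := by
  intro κ _ _ _ x hx
  obtain ⟨y, hy, hy0, hb⟩ := hx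
  have hglb := OrderContinuousDual.isGLB_posPart hg hy hy0
  rw [posPart_of_nonneg (hf.trans hfg)] at hglb
  refine ⟨fun i => f (y i), fun i j hij => mono hf (hy hij), ⟨?_, fun r hr => hglb.2 ?_⟩,
    fun i => ⟨?_, mono hf (hb i).2⟩⟩
  · rintro _ ⟨i, rfl⟩
    exact nonneg_apply hf (hy0.1 ⟨i, rfl⟩)
  · rintro _ ⟨i, rfl⟩
    exact (hr ⟨i, rfl⟩).trans (hfg _ (hy0.1 ⟨i, rfl⟩))
  · rw [← map_neg]
    exact mono hf (hb i).1

end RieszDual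

/-! ### Absolute continuity with respect to evaluation at the unit. -/

section SmallAtUnit

open Filter Topology

variable {A : Type u} [Ring A] [Lattice A] [IsOrderedRing A] [Algebra ℝ A] [IsOrderedModule ℝ A]
  [IsArchimedeanFAlgebra A]

/-- A supremum of positive functionals is at most their sum, and `2 - (1 / 2) ^ m` is the partial
geometric sum up to `k = m`. -/
theorem partialSups_apply_one_le {μ : ℕ → RieszDual A} (h0 : ∀ k, 0 ≤ μ k) {r : ℝ}
    (h : ∀ k, μ k 1 ≤ r * (1 / 2) ^ k) (m : ℕ) :
    (partialSups μ m) 1 ≤ r * (2 - (1 / 2) ^ m) := by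
  induction m with
  | zero =>
    have := h 0
    rw [partialSups_zero]
    norm_num at this ⊢
    exact this
  | succ m ih =>
    rw [partialSups_add_one]
    have h1 : partialSups μ m ⊔ μ (m + 1) ≤ partialSups μ m + μ (m + 1) :=
      sup_le (le_add_of_nonneg_right (h0 _))
        (le_add_of_nonneg_left ((h0 0).trans (le_partialSups_of_le μ (Nat.zero_le m))))
    have h2 := RieszDual.le_def.1 h1 1 zero_le_one
    rw [RieszDual.add_apply] at h2
    have h3 := h (m + 1)
    rw [pow_succ] at h3 ⊢
    linarith

/-- On an order interval `[0, φ]`, a positive order continuous functional on `A^~` is small at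
those functionals that are small at the unit of `A`. -/
theorem exists_apply_lt_of_apply_one_lt {F : RieszDual (RieszDual A)} (hF0 : 0 ≤ F)
    (hF : F ∈ OrderContinuousDual (RieszDual A)) (φ : RieszDual A) {ε : ℝ} (hε : 0 < ε) :
    ∃ δ > 0, ∀ μ, 0 ≤ μ → μ ≤ φ → μ 1 < δ → F μ < ε := by
  by_contra! hcon
  -- Borel–Cantelli: the values at `1` are summable, so the tail suprema `ρ n` of the `μ k`, `k ≥
  -- n`, which exist below `φ`, decrease to a limit vanishing at `1`, that is, to zero. Yet `F (ρ n)
  -- ≥ F (μ n) ≥ ε`.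
  choose μ hμ0 hμφ hμ1 hFμ using fun k : ℕ => hcon ((1 / 2) ^ k) (by positivity)
  have hmono : ∀ n, Monotone (partialSups fun k => μ (n + k)) := fun n => (partialSups _).monotone
  have hbdd : ∀ n m, partialSups (fun k => μ (n + k)) m ≤ φ := fun n m =>
    partialSups_le _ _ _ fun k _ => hμφ _
  choose ρ hρ using fun n => RieszDual.exists_tendsto_of_monotone (hmono n) (hbdd n)
  have hle : ∀ n m, partialSups (fun k => μ (n + k)) m ≤ ρ n := fun n m x hx =>
    ge_of_tendsto (hρ n x) (eventually_atTop.2 ⟨m, fun k hk => hmono n hk x hx⟩)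
  have hμρ : ∀ n, μ n ≤ ρ n := fun n => by simpa using hle n 0
  have hanti : Antitone ρ := antitone_nat_of_succ_le fun n x hx => by
    refine le_of_tendsto' (hρ (n + 1) x) fun m => ?_
    refine RieszDual.le_def.1 (le_trans (partialSups_le _ _ _ fun k hk => ?_) (hle n (m + 1))) x hx
    have := le_partialSups_of_le (fun k => μ (n + k)) (Nat.succ_le_succ hk)
    rwa [show n + 1 + k = n + (k + 1) by omega]
  have hρ1 : ∀ n, ρ n 1 ≤ (1 / 2) ^ n * 2 := fun n => by
    refine le_of_tendsto' (hρ n 1) fun m => ?_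
    have h1 := partialSups_apply_one_le (μ := fun k => μ (n + k)) (r := (1 / 2) ^ n)
      (fun k => hμ0 _) (fun k => by rw [← pow_add]; exact (hμ1 _).le) m
    refine h1.trans (mul_le_mul_of_nonneg_left ?_ (by positivity))
    have : (0 : ℝ) ≤ (1 / 2) ^ m := by positivity
    linarith
  have hρ0 : ∀ n, 0 ≤ ρ n := fun n => (hμ0 n).trans (hμρ n)
  -- The sequence is lifted because order continuity is tested on index sets in universe `u`.
  have hglb : IsGLB (Set.range fun i : ULift.{u} ℕ => ρ i.down) 0 := by
    refine ⟨?_, fun l hl => ?_⟩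
    · rintro _ ⟨i, rfl⟩
      exact hρ0 _
    · have hl' : ∀ n, l⁺ ≤ ρ n := fun n => by
        rw [posPart_def]
        exact sup_le (hl ⟨⟨n⟩, rfl⟩) (hρ0 n)
      have hlim : Tendsto (fun n : ℕ => ((1 : ℝ) / 2) ^ n * 2) atTop (𝓝 0) := by
        simpa using (tendsto_pow_atTop_nhds_zero_of_lt_one (r := (1 : ℝ) / 2) (by norm_num)
          (by norm_num)).mul_const 2
      have h1 : l⁺ 1 ≤ 0 := ge_of_tendsto' hlim fun n =>
        (RieszDual.le_def.1 (hl' n) 1 zero_le_one).trans (hρ1 n)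
      exact (le_posPart l).trans
        (IsArchimedeanFAlgebra.eq_zero_of_apply_one (posPart_nonneg l) h1).le
  obtain ⟨y, hy, hy0, hb⟩ := hF (ULift.{u} ℕ) (fun i => ρ i.down)
    (OrderTendstoZero.of_antitone (fun i j hij => hanti hij) hglb)
  refine absurd (hy0.2 ?_) (not_le.2 hε)
  rintro _ ⟨i, rfl⟩
  exact ((hFμ i.down).trans (RieszDual.mono hF0 (hμρ _))).trans (hb i).2

end SmallAtUnit

end RieszSpace

namespace RieszSpace

/-- A Hahn–Banach theorem: a linear functional that is dominated by a sublinear function of `T v`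
factors through `T`, with a factor dominated by this sublinear function. -/
theorem exists_extension_of_comp_le_sublinear {V : Type u} {W : Type v} [AddCommGroup V]
    [Module ℝ V] [AddCommGroup W] [Module ℝ W] (T : V →ₗ[ℝ] W) (μ : V →ₗ[ℝ] ℝ) (N : W → ℝ)
    (N_hom : ∀ c : ℝ, 0 < c → ∀ w, N (c • w) = c * N w) (N_add : ∀ v w, N (v + w) ≤ N v + N w)
    (h : ∀ v, μ v ≤ N (T v)) : ∃ g : W →ₗ[ℝ] ℝ, (∀ v, g (T v) = μ v) ∧ ∀ w, g w ≤ N w := by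
  have hN0 : N 0 = 0 := by
    have := N_hom 2 two_pos 0
    rw [smul_zero] at this
    linarith
  -- The domination at `v` and at `-v` makes `μ` vanish on the kernel of `T`; so `μ` descends to the
  -- range, from which Hahn–Banach extends it.
  have hker : ∀ v, T v = 0 → μ v = 0 := fun v hv => by
    have h1 := h v
    have h2 := h (-v)
    rw [map_neg, map_neg, hv, neg_zero, hN0] at h2
    rw [hv, hN0] at h1
    linarith
  obtain ⟨s, hs⟩ := T.rangeRestrict.exists_rightInverse_of_surjective T.range_rangeRestrict
  have hs' : ∀ w : T.range, T (s w) = w := fun w =>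
    congrArg Subtype.val (LinearMap.congr_fun hs w)
  obtain ⟨g, hg, hgN⟩ := exists_extension_of_le_sublinear ⟨T.range, μ ∘ₗ s⟩ N N_hom N_add
    (fun w => by
      have := h (s w)
      rwa [hs'] at this)
  refine ⟨g, fun v => ?_, hgN⟩
  have h1 : g (T v) = μ (s ⟨T v, v, rfl⟩) := hg ⟨T v, v, rfl⟩
  have h2 : μ (v - s ⟨T v, v, rfl⟩) = 0 := hker _ (by rw [map_sub, hs', sub_self])
  rw [map_sub] at h2
  linarith

/-! ### The Arens homomorphism. -/

section ArensHomomorphism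

variable {E : Type u} [AddCommGroup E] [Lattice E] [IsOrderedAddMonoid E] [Module ℝ E]
  [IsOrderedModule ℝ E] [HasSeparatingOrderDual E]

theorem bullet_mono {F : RieszDual (RieszDual ↥(Orth E))} (hF : 0 ≤ F) {f g : RieszDual E}
    (hfg : f ≤ g) : bullet F f ≤ bullet F g := by
  rw [← sub_nonneg, ← map_sub]
  exact bullet_nonneg hF (sub_nonneg.2 hfg)

theorem abs_bullet_le {F : RieszDual (RieszDual ↥(Orth E))} (hF : 0 ≤ F) (f : RieszDual E) :
    |bullet F f| ≤ bullet F |f| := by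
  refine abs_le'.2 ⟨bullet_mono hF (le_abs_self f), ?_⟩
  rw [← map_neg]
  exact bullet_mono hF (neg_le_abs f)

/-- For a positive order continuous `F`, the operator `f ↦ F • f` preserves disjointness. -/
theorem bullet_inf_eq_zero {F : RieszDual (RieszDual ↥(Orth E))} (hF0 : 0 ≤ F)
    (hF : F ∈ OrderContinuousDual (RieszDual ↥(Orth E))) {f g : RieszDual E} (hfg : f ⊓ g = 0) :
    bullet F f ⊓ g = 0 := by
  have hf : 0 ≤ f := hfg ▸ inf_le_left
  have hg : 0 ≤ g := hfg ▸ inf_le_right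
  refine RieszDual.ext_nonneg fun x hx => ?_
  refine le_antisymm (le_of_forall_pos_lt_add fun ε hε => ?_)
    (RieszDual.nonneg_apply (le_inf (bullet_nonneg hF0 hf) hg) hx)
  -- All `ψ_{y,f}` with `0 ≤ y ≤ x` lie in `[0, ψ_{x,f}]`, and their value at the unit is `f y`. So
  -- `δ` can be fixed before `y` is chosen.
  obtain ⟨δ, hδ, hsmall⟩ := exists_apply_lt_of_apply_one_lt hF0 hF (psi f x) (half_pos hε)
  obtain ⟨y, hy, hyx, hlt⟩ := RieszDual.exists_add_lt_inf_apply f g hx (lt_min hδ (half_pos hε))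
  rw [hfg, RieszDual.zero_apply, zero_add] at hlt
  have hfy := RieszDual.nonneg_apply hf hy
  have hgy := RieszDual.nonneg_apply hg (sub_nonneg.2 hyx)
  have h1 : F (psi f y) < ε / 2 := by
    refine hsmall _ (psi_nonneg hf hy) ?_ ?_
    · rw [← sub_nonneg, ← map_sub]
      exact psi_nonneg hf (sub_nonneg.2 hyx)
    · change f y < δ
      linarith [min_le_left δ (ε / 2)]
  have h2 := RieszDual.inf_apply_le (bullet F f) g hy hyx
  rw [bullet_apply] at h2
  rw [RieszDual.zero_apply]
  linarith [min_le_right δ (ε / 2)]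

/-- If `g ≥ 0` is disjoint from the band, it is disjoint from `|f|`, hence from `F • |f|`, which
dominates `|F • f|`. So `F • f` lies in the double disjoint complement of the band. -/
theorem bullet_mem_orth_of_nonneg {F : RieszDual (RieszDual ↥(Orth E))} (hF0 : 0 ≤ F)
    (hF : F ∈ OrderContinuousDual (RieszDual ↥(Orth E))) : bullet F ∈ Orth (RieszDual E) := by
  refine ⟨isOrderBounded_bullet F, fun B hB f hf => hB.mem_of_disjoint fun g hg hBg => ?_⟩
  exact inf_eq_zero_of_le (abs_nonneg _) hg (abs_bullet_le hF0 f)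
    (bullet_inf_eq_zero hF0 hF (hBg f hf))

/-- For order continuous `F`, the operator `f ↦ F • f` is an orthomorphism of `E^~`. -/
theorem bullet_mem_orth {F : RieszDual (RieszDual ↥(Orth E))}
    (hF : F ∈ OrderContinuousDual (RieszDual ↥(Orth E))) : bullet F ∈ Orth (RieszDual E) := by
  have h : bullet F = bullet F⁺ - bullet F⁻ := by
    ext f x
    conv_lhs => rw [bullet_apply, F.eq_sub]
    rfl
  rw [h]
  exact Subalgebra.sub_mem _
    (bullet_mem_orth_of_nonneg (posPart_nonneg F) (OrderContinuousDual.posPart_mem hF))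
    (bullet_mem_orth_of_nonneg (negPart_nonneg F) (OrderContinuousDual.negPart_mem hF))

/-- A functional on `Orth(E)` between `0` and `ψ_{x,f}` is of the form `ψ_{x,g}` with
`0 ≤ g ≤ f`. -/
theorem exists_psi_eq {f : RieszDual E} (hf : 0 ≤ f) {x : E} (hx : 0 ≤ x)
    {μ : RieszDual ↥(Orth E)} (hμ0 : 0 ≤ μ) (hμ : μ ≤ psi f x) :
    ∃ g : RieszDual E, 0 ≤ g ∧ g ≤ f ∧ psi g x = μ := by
  -- This is domination by the sublinear functional `v ↦ f v⁺` at `v = π x`, since `π⁺ x = (π x)⁺`.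
  -- An extension `g` below it satisfies `g ≤ f` (test `v ≥ 0`) and `g ≥ 0` (test `-v`).
  have hdom : ∀ π : ↥(Orth E), μ π ≤ f (π.1 x)⁺ := fun π => by
    rw [← Orth.posPart_apply π hx, ← psi_apply]
    exact (RieszDual.mono hμ0 (le_posPart π)).trans (hμ _ (posPart_nonneg π))
  obtain ⟨g, hg, hgN⟩ := exists_extension_of_comp_le_sublinear (orthEval x) μ.toLin
    (fun v => f v⁺)
    (fun c hc v => by rw [posPart_smul_of_nonneg hc.le, map_smul, smul_eq_mul])
    (fun v w => by
      rw [← map_add]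
      refine RieszDual.mono hf ?_
      rw [posPart_def (v + w)]
      exact sup_le (add_le_add (le_posPart v) (le_posPart w))
        (add_nonneg (posPart_nonneg v) (posPart_nonneg w)))
    hdom
  have hg0 : ∀ v, 0 ≤ v → 0 ≤ g v := fun v hv => by
    have := hgN (-v)
    rw [posPart_of_nonpos (neg_nonpos.2 hv), map_zero, map_neg] at this
    linarith
  refine ⟨RieszDual.mk g (IsOrderBounded.of_nonneg hg0), hg0, fun v hv => ?_, ?_⟩
  · have := hgN v
    rwa [posPart_of_nonneg hv] at this
  · ext π
    exact hg π

/-- The map `F ↦ F • f` preserves disjointness for `f ≥ 0`. -/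
theorem bullet_inf_bullet_eq_zero {F G : RieszDual (RieszDual ↥(Orth E))} (hFG : F ⊓ G = 0)
    (hF : F ∈ OrderContinuousDual (RieszDual ↥(Orth E)))
    (hG : G ∈ OrderContinuousDual (RieszDual ↥(Orth E))) {f : RieszDual E} (hf : 0 ≤ f) :
    bullet F f ⊓ bullet G f = 0 := by
  have hF0 : 0 ≤ F := hFG ▸ inf_le_left
  have hG0 : 0 ≤ G := hFG ▸ inf_le_right
  let S : ↥(Orth (RieszDual E)) := ⟨bullet F, bullet_mem_orth hF⟩
  let T : ↥(Orth (RieszDual E)) := ⟨bullet G, bullet_mem_orth hG⟩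
  have hST : ∀ h : RieszDual E, 0 ≤ h → (S ⊓ T).1 h = bullet F h ⊓ bullet G h :=
    fun h hh => Orth.inf_apply S T hh
  refine RieszDual.ext_nonneg fun x hx => ?_
  refine le_antisymm (le_of_forall_pos_lt_add fun ε hε => ?_)
    (RieszDual.nonneg_apply (le_inf (bullet_nonneg hF0 hf) (bullet_nonneg hG0 hf)) hx)
  obtain ⟨μ, hμ0, hμ, hlt⟩ := RieszDual.exists_add_lt_inf_apply F G (psi_nonneg hf hx) hε
  obtain ⟨g, hg0, hgf, rfl⟩ := exists_psi_eq hf hx hμ0 hμ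
  have hfg : 0 ≤ f - g := sub_nonneg.2 hgf
  -- The left side is the value at `f` of the single linear operator `S ⊓ T`, so it splits along `f
  -- = g + (f - g)`. This uses that both operators are orthomorphisms.
  have h1 : bullet F f ⊓ bullet G f ≤ bullet F g + bullet G (f - g) := by
    rw [← hST f hf, ← add_sub_cancel g f, map_add, hST g hg0, add_sub_cancel, hST _ hfg]
    exact add_le_add inf_le_left inf_le_right
  rw [hFG] at hlt
  exact (h1 x hx).trans_lt hlt

theorem arensHom_one : arensHom E 1 = 1 := rfl

/-- After unfolding, the two sides compare `f (π (σ x))` with `f (σ (π x))`: the only input is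
commutativity of `Orth(E)`. -/
theorem arensHom_mul (F G : OrderBidual ↥(Orth E)) :
    arensHom E (F * G) = arensHom E F * arensHom E G := by
  refine Subtype.ext (LinearMap.ext fun f => RieszDual.ext fun x => ?_)
  change F.1 (bidualAct G.1 (psi f x)) = F.1 (psi (bullet G.1 f) x)
  congr 1
  ext π
  change G.1 (dualAct (psi f x) π) = G.1 (psi f (π.1 x))
  congr 1
  ext σ
  rw [dualAct_apply, IsArchimedeanFAlgebra.mul_comm]
  rfl

theorem arensHom_mono {F G : OrderBidual ↥(Orth E)} (h : F ≤ G) : arensHom E F ≤ arensHom E G :=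
  fun _ hf _ hx => RieszDual.le_def.1 (show F.1 ≤ G.1 from h) _ (psi_nonneg hf hx)

theorem isOrderContinuous_arensHom : IsOrderContinuous (arensHom E) := by
  intro ι _ _ _ F hF
  obtain ⟨Y, hY, hY0, hb⟩ := hF
  -- The infimum is given only among order continuous functionals. A lower bound `G` in `A^~~` has
  -- `G⁺` below every `Y i`, so `G⁺` is itself order continuous and must be zero.
  have hglb : IsGLB (Set.range fun i => (Y i).1) 0 := by
    refine ⟨?_, fun G hG => ?_⟩
    · rintro _ ⟨i, rfl⟩
      exact hY0.1 ⟨i, rfl⟩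
    · have hle : ∀ i, G⁺ ≤ (Y i).1 := fun i => by
        rw [posPart_def]
        exact sup_le (hG ⟨i, rfl⟩) (hY0.1 ⟨i, rfl⟩)
      have hmem : G⁺ ∈ OrderContinuousDual (RieszDual ↥(Orth E)) :=
        RieszDual.mem_orderContinuousDual_of_le (posPart_nonneg G)
          (hle (Classical.arbitrary ι)) (Y _).2
      have h0 : (⟨G⁺, hmem⟩ : OrderBidual ↥(Orth E)) ≤ 0 := by
        refine hY0.2 ?_
        rintro _ ⟨i, rfl⟩
        exact hle i
      exact (le_posPart G).trans h0
  refine ⟨fun i => arensHom E (Y i), fun i j hij => arensHom_mono (hY hij), ⟨?_, ?_⟩, fun i => ?_⟩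
  · rintro _ ⟨i, rfl⟩
    rw [← map_zero (arensHom E)]
    exact arensHom_mono (hY0.1 ⟨i, rfl⟩)
  · intro T hT f hf x hx
    refine (RieszDual.isGLB_apply (fun i j hij => hY hij) hglb (psi_nonneg hf hx)).2 ?_
    rintro _ ⟨i, rfl⟩
    exact hT ⟨i, rfl⟩ f hf x hx
  · rw [← map_neg]
    exact ⟨arensHom_mono (hb i).1, arensHom_mono (hb i).2⟩

theorem isRieszHom_arensHom : IsRieszHom (arensHom E) := by
  intro F G
  have hsup : F.1 ⊔ G.1 = (F.1 - G.1)⁺ + G.1 := by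
    rw [posPart_def, sup_add, sub_add_cancel, zero_add]
  have hFG : F.1 - G.1 ∈ OrderContinuousDual (RieszDual ↥(Orth E)) := Submodule.sub_mem _ F.2 G.2
  have hpos := OrderContinuousDual.posPart_mem hFG
  have hneg := OrderContinuousDual.negPart_mem hFG
  have hdisj : (F.1 - G.1)⁺ ⊓ (F.1 - G.1)⁻ = 0 := posPart_inf_negPart_eq_zero (F.1 - G.1)
  have hmem : F.1 ⊔ G.1 ∈ OrderContinuousDual (RieszDual ↥(Orth E)) := by
    rw [hsup]
    exact Submodule.add_mem _ hpos G.2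
  have hlub : IsLUB {F, G} (⟨F.1 ⊔ G.1, hmem⟩ : OrderBidual ↥(Orth E)) := by
    refine ⟨?_, fun H hH => ?_⟩
    · rintro H (hH | hH)
      · rw [hH]
        exact (le_sup_left : F.1 ≤ F.1 ⊔ G.1)
      · rw [Set.mem_singleton_iff.1 hH]
        exact (le_sup_right : G.1 ≤ F.1 ⊔ G.1)
    · exact (sup_le (hH (Set.mem_insert _ _)) (hH (Set.mem_insert_of_mem _ rfl)) :
        F.1 ⊔ G.1 ≤ H.1)
  refine ⟨_, hlub, ?_, fun T hT f hf => ?_⟩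
  · rintro T (hT | hT)
    · rw [hT]
      exact arensHom_mono (hlub.1 (Set.mem_insert _ _))
    · rw [Set.mem_singleton_iff.1 hT]
      exact arensHom_mono (hlub.1 (Set.mem_insert_of_mem _ rfl))
  -- The elements `a` and `b` below are disjoint with difference `F • f - G • f`, so `a` is the
  -- positive part of that difference. Hence `(F ⊔ G) • f` is the supremum of `F • f` and `G • f` in
  -- `E^~`.
  · have hTF : bullet F.1 f ≤ T.1 f := hT (Set.mem_insert _ _) f hf
    have hTG : bullet G.1 f ≤ T.1 f := hT (Set.mem_insert_of_mem _ rfl) f hf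
    set a := bullet (F.1 - G.1)⁺ f with ha
    set b := bullet (F.1 - G.1)⁻ f with hb
    have hab : a ⊓ b = 0 :=
      bullet_inf_bullet_eq_zero hdisj hpos hneg hf
    have hsub : a - b = bullet F.1 f - bullet G.1 f := by
      ext x
      exact DFunLike.congr_fun (RieszDual.eq_sub (F.1 - G.1)).symm (psi f x)
    have ha' : a = (a - b)⁺ := by
      rw [inf_eq_sub_posPart_sub] at hab
      exact sub_eq_zero.1 hab
    have h1 : a ≤ T.1 f - bullet G.1 f := by
      rw [ha', hsub, posPart_def]
      exact sup_le (sub_le_sub_right hTF _) (sub_nonneg.2 hTG)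
    have h2 : bullet (F.1 ⊔ G.1) f = a + bullet G.1 f := by
      rw [hsup]
      rfl
    change bullet (F.1 ⊔ G.1) f ≤ T.1 f
    rw [h2]
    exact le_sub_iff_add_le.1 h1

end ArensHomomorphism

end RieszSpace

theorem proposition1 {E : Type*} [AddCommGroup E] [Lattice E] [IsOrderedAddMonoid E] [Module ℝ E]
    [IsOrderedModule ℝ E] [HasSeparatingOrderDual E] :
    -- `γ` is a unital algebra homomorphism (it is linear by construction)
    arensHom E 1 = 1 ∧
    (∀ F G : OrderBidual ↥(Orth E), arensHom E (F * G) = arensHom E F * arensHom E G) ∧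
    -- `γ` is order continuous
    IsOrderContinuous (arensHom E) ∧
    -- `γ` is a Riesz homomorphism
    IsRieszHom (arensHom E) ∧
    -- `γ` extends the map that takes an orthomorphism to its adjoint
    (∀ π : ↥(Orth E), (arensHom E (bidualEval π) : Module.End ℝ (RieszDual E)) = Orth.adjoint π) ∧
    -- the range of `γ` is contained in `Orth(E^~)`
    (∀ F : OrderBidual ↥(Orth E),
      (arensHom E F : Module.End ℝ (RieszDual E)) ∈ Orth (RieszDual E)) := by

  exact ⟨arensHom_one, arensHom_mul, isOrderContinuous_arensHom, isRieszHom_arensHom,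
    fun _ => rfl, fun F => bullet_mem_orth F.2⟩
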